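/- For each integer $d\ge 0$ let $X_d(x)=\sum_{n=0}^d a_n^{(d)}x^n$ be the Kostlan–Shub–Smale random polynomial of degree $d$: the coefficients $a_0^{(d)},\dots,a_d^{(d)}$ are independent centered Gaussian random variables with $\operatorname{Var}(a_n^{(d)})=\binom{d}{n}$. Let $N_d=\#\{x\in\mathbb R: X_d(x)=0\}$ be the number of real roots of $X_d$ (almost surely finite). For $t>0$ put $$g(t)=\frac{1-(1+t^2)e^{-t^2}}{(1-e^{-t^2})^{3/2}},\qquad \rho(t)=e^{-t^2/2}\,\frac{1-t^2-e^{-t^2}}{1-e^{-t^2}-t^2e^{-t^2}}.$$ Then $N_d$ is square integrable for every $d$, the function $$t\mapsto g(t)\left[\sqrt{1-\rho^2(t)}+\rho(t)\arctan\left(\frac{\rho(t)}{\sqrt{1-\rho^2(t)}}\right)\right]-1$$ is Lebesgue integrable on $(0,\infty)$, so that $$\sigma^2:=\frac{2}{\pi}\int_0^\infty\left(g(t)\left[\sqrt{1-\rho^2(t)}+\rho(t)\arctan\left(\frac{\rho(t)}{\sqrt{1-\rho^2(t)}}\right)\right]-1\right)dt+1$$ is finite, and $$\lim_{d\to\infty}\frac{\operatorname{Var}(N_d)}{\sqrt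 d}=\sigma^2.$$ -/

import Mathlib

open MeasureTheory ProbabilityTheory Filter Topology

noncomputable section

/-- The value at `x` of the polynomial of degree (at most) `d` with coefficients `c 0, …, c d`. -/
def polyValue {d : ℕ} (c : Fin (d + 1) → ℝ) (x : ℝ) : ℝ :=
  ∑ n : Fin (d + 1), c n * x ^ (n : ℕ)

/-- The number of distinct real roots of the polynomial with coefficients `c`.
(For the zero polynomial, an event of probability zero below, this is the default value `0`.) -/
def numRealRoots {d : ℕ} (c : Fin (d + 1) → ℝ) : ℕ :=
  {x : ℝ | polyValue c x = 0}.ncard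

/-- The coefficients of the Kostlan-Shub-Smale random polynomial of degree `d`: independent
centered Gaussian random variables, the `n`-th one having variance `d.choose n`. -/
structure IsKSS {Ω : Type*} [MeasurableSpace Ω] (P : Measure Ω) (d : ℕ)
    (a : Fin (d + 1) → Ω → ℝ) : Prop where
  indep : iIndepFun a P
  law : ∀ n : Fin (d + 1), HasLaw (a n) (gaussianReal 0 (d.choose n : NNReal)) P

/-- The number `N_d` of real roots of the random polynomial with coefficients `a`,
as a real random variable. -/
def rootCount {Ω : Type*} {d : ℕ} (a : Fin (d + 1) → Ω → ℝ) (ω : Ω) : ℝ :=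
  (numRealRoots fun n => a n ω : ℝ)

/-- The function `g(t) = (1 - (1 + t²) e^{-t²}) / (1 - e^{-t²})^{3/2}`. -/
def kssG (t : ℝ) : ℝ :=
  (1 - (1 + t ^ 2) * Real.exp (-t ^ 2)) / (1 - Real.exp (-t ^ 2)) ^ (3 / 2 : ℝ)

/-- The function `ρ(t) = e^{-t²/2} (1 - t² - e^{-t²}) / (1 - e^{-t²} - t² e^{-t²})`. -/
def kssRho (t : ℝ) : ℝ :=
  Real.exp (-t ^ 2 / 2) *
    ((1 - t ^ 2 - Real.exp (-t ^ 2)) /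
      (1 - Real.exp (-t ^ 2) - t ^ 2 * Real.exp (-t ^ 2)))

/-- The integrand `g [√(1 - ρ²) + ρ arctan (ρ / √(1 - ρ²))] - 1` in the limit variance. -/
def kssIntegrand (t : ℝ) : ℝ :=
  kssG t * (√(1 - kssRho t ^ 2) +
    kssRho t * Real.arctan (kssRho t / √(1 - kssRho t ^ 2))) - 1

end

/-!
The proof is an exact Kac-Rice computation of the first two moments of the number of real roots,
followed by dominated convergence.

In the angular variable `x = tan θ`, the process `cos θ ^ d * X (tan θ)` is stationary with
covariance `cos (θ - φ) ^ d`, and its zeros on `(-π / 2, π / 2)` are the roots of `X`. For fixed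
higher coefficients, the ordered pairs of distinct roots of `X` are the fibre, over the two lowest
coefficients, of an explicit smooth map of pairs of angles, `pairSolution`. The area formula with
multiplicity (`lintegral_encard_fiber_mul`) therefore writes the mean of `N * (N - 1)` as an
integral over pairs of angles of the mean of the absolute value of a Jacobian. Gaussian regression
of the derivatives on the values (`IsStationaryGram.map_eq`, `lintegral_density_mul_of_law`)
and the mean of `|U * V|` for a Gaussian pair (`lintegral_abs_mul_gaussian`) evaluate the integrand:
it is `pairDensity d (θ - φ)`, an explicit function (`lintegral_factorial_numRealRoots`). In the same
way the mean of `N` is `√d` (`lintegral_numRealRoots`). Both formulas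
are exact for each `d`.

By periodicity, the variance divided by `√d` is `2 / π` times the integral over
`(0, √d * π / 2]` of `scaledProfile d t - 1`, plus `1` (`variance_numRealRoots_div_sqrt`), where
`scaledProfile d t` is the density of pairs at angle `t / √d`, normalized to be `1` for independent
zeros. The covariance `cos (t / √d) ^ d` tends to `exp (-t ^ 2 / 2)` together with its derivatives,
hence `scaledProfile d t - 1` tends to `kssIntegrand t` (`tendsto_scaledProfile`,
`kssIntegrand_eq`). The domination (`abs_scaledProfile_sub_one_le`) has two sources: for large `t`
the covariance and its derivatives are bounded by a polynomial times `exp (-t ^ 2 / 24)`, uniformly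
in `d`, and the profile differs from `1` by at most a multiple of that; for small `t` the profile is
bounded because the conditional variance of the derivative given two nearby zeros vanishes to the
right order. The same bound shows that the limit is integrable.
-/

/-! ### The area formula, counting multiplicity -/

section AreaFormula

open Set
open scoped ENNReal NNReal

variable {E : Type*} [NormedAddCommGroup E] [NormedSpace ℝ E] [FiniteDimensional ℝ E]
  [MeasurableSpace E] [BorelSpace E]

/-- The area formula with multiplicity: `s` is cut into countably many pieces on which `f` is
injective, apart from the set where `f'` is singular, whose image is null by Sard's lemma. -/
theorem lintegral_encard_fiber_mul (μ : Measure E) [μ.IsAddHaarMeasure] {s : Set E}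
    (hs : MeasurableSet s) {f : E → E} {f' : E → E →L[ℝ] E}
    (hf' : ∀ x ∈ s, HasFDerivWithinAt f (f' x) s x) (hdet : Measurable fun x => (f' x).det)
    {g : E → ℝ≥0∞} (hg : Measurable g) :
    ∫⁻ y, ((s ∩ f ⁻¹' {y}).encard : ℝ≥0∞) * g y ∂μ =
      ∫⁻ x in s, ENNReal.ofReal |(f' x).det| * g (f x) ∂μ := by
  classical
  set Z : Set E := {x | (f' x).det = 0} with hZ
  have hZm : MeasurableSet Z := hdet (measurableSet_singleton 0)
  have hZ0 : μ (f '' (s ∩ Z)) = 0 :=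
    addHaar_image_eq_zero_of_det_fderivWithin_eq_zero μ
      (fun x hx => (hf' x hx.1).mono inter_subset_left) fun x hx => hx.2
  set s₁ := s \ Z with hs₁
  have hs₁m : MeasurableSet s₁ := hs.diff hZm
  have hf₁ : ∀ x ∈ s₁, HasFDerivWithinAt f (f' x) s₁ x :=
    fun x hx => (hf' x hx.1).mono sdiff_subset
  -- approximation radius guaranteeing injectivity for invertible linear maps
  have hr : ∀ A : E →L[ℝ] E, ∃ r : ℝ≥0, r ≠ 0 ∧ (A.det ≠ 0 → ∀ t : Set E,
      ApproximatesLinearOn f A t r → InjOn f t) := by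
    intro A
    by_cases hA : A.det = 0
    · exact ⟨1, one_ne_zero, fun h => absurd hA h⟩
    set B := A.toContinuousLinearEquivOfDetNeZero hA
    have hB : (B : E →L[ℝ] E) = A := A.coe_toContinuousLinearEquivOfDetNeZero hA
    rcases subsingleton_or_nontrivial E with hE | hE
    · exact ⟨1, one_ne_zero, fun _ t _ => injOn_of_subsingleton f t⟩
    have hpos : 0 < ‖(B.symm : E →L[ℝ] E)‖₊⁻¹ := by
      have := B.nnnorm_symm_pos
      positivity
    refine ⟨‖(B.symm : E →L[ℝ] E)‖₊⁻¹ / 2, (half_pos hpos).ne', fun _ t ht => ?_⟩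
    rw [← hB] at ht
    exact ht.injOn (Or.inr (NNReal.half_lt_self hpos.ne'))
  choose r hr0 hrinj using hr
  obtain ⟨t, A, htd, htm, hst, happ, hne⟩ :=
    exists_partition_approximatesLinearOn_of_hasFDerivWithinAt f s₁ f' hf₁ r hr0
  have hinj : ∀ n, InjOn f (s₁ ∩ t n) := by
    intro n
    rcases s₁.eq_empty_or_nonempty with h | h
    · simp [h]
    · obtain ⟨y, hy, hAy⟩ := hne h n
      exact hrinj (A n) (by rw [hAy]; exact hy.2) _ (happ n)
  have hpm : ∀ n, MeasurableSet (s₁ ∩ t n) := fun n => hs₁m.inter (htm n)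
  have hpd : ∀ n, ∀ x ∈ s₁ ∩ t n, HasFDerivWithinAt f (f' x) (s₁ ∩ t n) x :=
    fun n x hx => (hf₁ x hx.1).mono inter_subset_left
  have him : ∀ n, MeasurableSet (f '' (s₁ ∩ t n)) :=
    fun n => measurable_image_of_fderivWithin (hpm n) (hpd n) (hinj n)
  have hcover : ⋃ n, s₁ ∩ t n = s₁ := by
    rw [← inter_iUnion]; exact inter_eq_left.2 hst
  have hdisj : Pairwise (Function.onFun Disjoint fun n => s₁ ∩ t n) := fun i j hij =>
    (htd hij).mono inter_subset_right inter_subset_right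
  -- the fibre cardinality is the number of pieces whose image contains the point
  have hfib : ∀ y, ((s₁ ∩ f ⁻¹' {y}).encard : ℝ≥0∞) =
      ∑' n, (f '' (s₁ ∩ t n)).indicator 1 y := by
    intro y
    have hsub : ∀ n, ((s₁ ∩ t n) ∩ f ⁻¹' {y}).Subsingleton := fun n a ha b hb =>
      hinj n ha.1 hb.1 (ha.2.trans hb.2.symm)
    have h1 : s₁ ∩ f ⁻¹' {y} = ⋃ n, (s₁ ∩ t n) ∩ f ⁻¹' {y} := by
      rw [← iUnion_inter, hcover]
    have hms : MeasurableSet (s₁ ∩ f ⁻¹' {y}) := by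
      rw [h1]; exact MeasurableSet.iUnion fun n => (hsub n).measurableSet
    rw [← Measure.count_apply hms, h1, measure_iUnion]
    · congr 1; ext n
      rw [Measure.count_apply (hsub n).measurableSet]
      rcases (hsub n).eq_empty_or_singleton with h | ⟨x, h⟩
      · rw [h, indicator_of_notMem]
        · simp
        · rintro ⟨x, hx, hxy⟩
          exact (h ▸ (⟨hx, hxy⟩ : x ∈ (s₁ ∩ t n) ∩ f ⁻¹' {y}) : x ∈ (∅ : Set E))
      · rw [h, indicator_of_mem]
        · simp
        · have : x ∈ (s₁ ∩ t n) ∩ f ⁻¹' {y} := h ▸ mem_singleton x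
          exact ⟨x, this.1, this.2⟩
    · exact fun i j hij => (hdisj hij).mono inter_subset_left inter_subset_left
    · exact fun n => (hsub n).measurableSet
  have hae : ∀ᵐ y ∂μ, ((s ∩ f ⁻¹' {y}).encard : ℝ≥0∞) * g y =
      ∑' n, (f '' (s₁ ∩ t n)).indicator g y := by
    filter_upwards [measure_eq_zero_iff_ae_notMem.1 hZ0] with y hy
    have : s ∩ f ⁻¹' {y} = s₁ ∩ f ⁻¹' {y} := by
      ext x
      simp only [mem_inter_iff, mem_preimage, mem_singleton_iff, hs₁, Set.mem_sdiff]
      refine ⟨fun h => ⟨⟨h.1, fun hz => hy ⟨x, ⟨h.1, hz⟩, h.2⟩⟩, h.2⟩, fun h => ⟨h.1.1, h.2⟩⟩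
    rw [this, hfib, ← ENNReal.tsum_mul_right]
    congr 1; ext n
    by_cases h : y ∈ f '' (s₁ ∩ t n) <;> simp [h]
  rw [lintegral_congr_ae hae, lintegral_tsum fun n => (hg.indicator (him n)).aemeasurable]
  have hpiece : ∀ n, ∫⁻ y, (f '' (s₁ ∩ t n)).indicator g y ∂μ =
      ∫⁻ x in s₁ ∩ t n, ENNReal.ofReal |(f' x).det| * g (f x) ∂μ := fun n => by
    rw [lintegral_indicator (him n),
      lintegral_image_eq_lintegral_abs_det_fderiv_mul μ (hpm n) (hpd n) (hinj n)]
  simp_rw [hpiece]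
  rw [← lintegral_iUnion hpm hdisj, hcover, ← lintegral_inter_add_sdiff _ s hZm]
  have : ∫⁻ x in s ∩ Z, ENNReal.ofReal |(f' x).det| * g (f x) ∂μ = 0 := by
    rw [setLIntegral_congr_fun (g := fun _ => 0) (hs.inter hZm) fun x hx => by
      have : (f' x).det = 0 := hx.2
      simp [this]]
    simp
  rw [this, zero_add]

/-- The area formula for a family of maps, integrated over the parameter and with the order of
integration exchanged: this is the general form of the Kac-Rice formula used below. -/
theorem lintegral_lintegral_encard_fiber_mul {R : Type*} [MeasurableSpace R] (ν : Measure R)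
    [SFinite ν] (μ : Measure E) [μ.IsAddHaarMeasure] {s : Set E} (hs : MeasurableSet s)
    {F : R → E → E} {F' : R → E → E →L[ℝ] E}
    (hF' : ∀ r, ∀ x ∈ s, HasFDerivWithinAt (F r) (F' r x) s x)
    (hdet : Measurable fun p : R × E => (F' p.1 p.2).det)
    (hF : Measurable fun p : R × E => F p.1 p.2)
    {g : E → ℝ≥0∞} (hg : Measurable g) :
    ∫⁻ r, ∫⁻ y, ((s ∩ F r ⁻¹' {y}).encard : ℝ≥0∞) * g y ∂μ ∂ν =
      ∫⁻ x in s, ∫⁻ r, ENNReal.ofReal |(F' r x).det| * g (F r x) ∂ν ∂μ := by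
  have hm : Measurable fun p : R × E => ENNReal.ofReal |(F' p.1 p.2).det| * g (F p.1 p.2) :=
    (ENNReal.measurable_ofReal.comp (continuous_abs.measurable.comp hdet)).mul (hg.comp hF)
  rw [← lintegral_lintegral_swap (f := fun r x => ENNReal.ofReal |(F' r x).det| * g (F r x))
    hm.aemeasurable]
  refine lintegral_congr fun r => ?_
  exact lintegral_encard_fiber_mul μ hs (hF' r) (hdet.comp measurable_prodMk_left) hg

end AreaFormula

/-! ### Conditioning a Gaussian vector on the value of an affine function -/

section ConditionalDensity

open scoped ENNReal NNReal BoundedContinuousFunction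

variable {B : Type*} [NormedAddCommGroup B] [NormedSpace ℝ B] [FiniteDimensional ℝ B]
  [MeasurableSpace B] [BorelSpace B]
  {R : Type*} [MeasurableSpace R]
  {W : Type*} [TopologicalSpace W] [MeasurableSpace W] [BorelSpace W] [HasOuterApproxClosed W]

theorem lintegral_comp_sub_continuousLinearMap (lam : Measure B) [lam.IsAddHaarMeasure]
    (M : B →L[ℝ] B) (hM : M.det ≠ 0) (a : B) (g : B → ℝ≥0∞) :
    ∫⁻ b, g b ∂lam = ENNReal.ofReal |M.det|⁻¹ *
      ∫⁻ u, g (a + (M.toContinuousLinearEquivOfDetNeZero hM).symm u) ∂lam := by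
  set e := M.toContinuousLinearEquivOfDetNeZero hM
  have he : (e : B →L[ℝ] B) = M := M.coe_toContinuousLinearEquivOfDetNeZero hM
  have h1 : lam.map e = ENNReal.ofReal |M.det⁻¹| • lam := by
    have := Measure.map_linearMap_addHaar_eq_smul_addHaar lam (f := (M : B →ₗ[ℝ] B)) hM
    have h2 : (e : B → B) = (M : B →ₗ[ℝ] B) := by ext x; simp [e]
    rw [h2, this]
  have h3 : ENNReal.ofReal |M.det⁻¹| * ∫⁻ u, g (a + e.symm u) ∂lam = ∫⁻ b, g (a + b) ∂lam := by
    have : ∫⁻ u, g (a + e.symm u) ∂(lam.map e) = ∫⁻ b, g (a + b) ∂lam := by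
      have := lintegral_map_equiv (μ := lam) (fun u => g (a + e.symm u))
        e.toHomeomorph.toMeasurableEquiv
      simpa using this
    rw [← this, h1, lintegral_smul_measure, smul_eq_mul]
  rw [← abs_inv, h3, lintegral_add_left_eq_self (μ := lam) g a]

/-- Conditioning on the event `b = F r`, where `b` has density `φ` and `r` has law `ν`. If
`M (b - F r)` has density `ψ` and is independent of `U r b`, which has law `κ`, then the integral
over this event against the density of `b` is that of `G` against `κ`, up to the factor
`|M.det| * ψ 0`. The independence gives the identity for almost every level `M (b - F r) = u`;
for bounded continuous `G` both sides are continuous in `u`, so it holds at `u = 0`; bounded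
continuous functions determine the measures, which gives all measurable `G`. -/
theorem lintegral_density_mul_of_law (lam : Measure B) [lam.IsAddHaarMeasure]
    (ν : Measure R) [IsProbabilityMeasure ν]
    {φ ψ : B → ℝ} (hφ : Continuous φ) (hφ0 : ∀ b, 0 ≤ φ b) {C : ℝ} (hφC : ∀ b, φ b ≤ C)
    (hψ : Continuous ψ) (M : B →L[ℝ] B) (hM : M.det ≠ 0)
    {F : R → B} (hF : Measurable F) {U : R → B → W} (hU : ∀ r, Continuous (U r))
    (hUm : Measurable fun p : R × B => U p.1 p.2) (κ : Measure W) [IsFiniteMeasure κ]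
    (hlaw : ∀ (h : B → ℝ≥0∞) (G : W → ℝ≥0∞), Measurable h → Measurable G →
      ∫⁻ r, ∫⁻ b, ENNReal.ofReal (φ b) * (h (M (b - F r)) * G (U r b)) ∂lam ∂ν =
        (∫⁻ u, h u * ENNReal.ofReal (ψ u) ∂lam) * ∫⁻ w, G w ∂κ)
    {G : W → ℝ≥0∞} (hG : Measurable G) :
    ∫⁻ r, ENNReal.ofReal (φ (F r)) * G (U r (F r)) ∂ν =
      ENNReal.ofReal |M.det| * ENNReal.ofReal (ψ 0) * ∫⁻ w, G w ∂κ := by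
  have hC0 : 0 ≤ C := (hφ0 0).trans (hφC 0)
  have hdet : 0 < |M.det| := abs_pos.2 hM
  set e := M.toContinuousLinearEquivOfDetNeZero hM with he
  have hUF : ∀ u : B, Measurable fun r => U r (F r + e.symm u) := fun u =>
    hUm.comp (measurable_id.prodMk (hF.add_const _))
  -- the identity for bounded continuous `G`, at all levels `u`
  have key : ∀ G : W →ᵇ ℝ≥0, ∫⁻ r, ENNReal.ofReal (φ (F r)) * G (U r (F r)) ∂ν =
      ENNReal.ofReal |M.det| * ENNReal.ofReal (ψ 0) * ∫⁻ w, G w ∂κ := by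
    intro G
    set Ψ : B → ℝ≥0∞ := fun u =>
      ∫⁻ r, ENNReal.ofReal (φ (F r + e.symm u)) * G (U r (F r + e.symm u)) ∂ν with hΨ
    set Φ : B → ℝ≥0∞ := fun u =>
      ENNReal.ofReal |M.det| * ENNReal.ofReal (ψ u) * ∫⁻ w, G w ∂κ with hΦ
    have hGfin : ∫⁻ w, (G w : ℝ≥0∞) ∂κ ≠ ∞ := (G.lintegral_lt_top_of_nnreal κ).ne
    have hΦc : Continuous Φ := by
      refine (ENNReal.continuous_mul_const hGfin).comp
        ((ENNReal.continuous_const_mul ENNReal.ofReal_ne_top).comp ?_)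
      exact ENNReal.continuous_ofReal.comp hψ
    have hΨr : Ψ = fun u => ENNReal.ofReal
        (∫ r, φ (F r + e.symm u) * (G (U r (F r + e.symm u)) : ℝ) ∂ν) := by
      ext u
      rw [ofReal_integral_eq_lintegral_ofReal]
      · refine lintegral_congr fun r => ?_
        rw [ENNReal.ofReal_mul (hφ0 _), ENNReal.ofReal_coe_nnreal]
      · refine Integrable.of_bound (C := C * nndist G 0) ?_ (ae_of_all _ fun r => ?_)
        · exact ((hφ.measurable.comp (hF.add_const _)).mul
            (measurable_coe_nnreal_real.comp
              (G.continuous.measurable.comp (hUF u)))).aestronglyMeasurable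
        · rw [norm_mul]
          gcongr
          · rw [Real.norm_of_nonneg (hφ0 _)]; exact hφC _
          · rw [Real.norm_of_nonneg (NNReal.coe_nonneg _)]
            exact NNReal.coe_le_coe.2 (BoundedContinuousFunction.NNReal.upper_bound G _)
      · exact ae_of_all _ fun r => mul_nonneg (hφ0 _) (NNReal.coe_nonneg _)
    have hΨc : Continuous Ψ := by
      rw [hΨr]
      refine ENNReal.continuous_ofReal.comp
        (continuous_of_dominated (bound := fun _ => C * nndist G 0) ?_ ?_ (integrable_const _) ?_)
      · intro u
        exact ((hφ.measurable.comp (hF.add_const _)).mul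
            (measurable_coe_nnreal_real.comp
              (G.continuous.measurable.comp (hUF u)))).aestronglyMeasurable
      · intro u
        refine ae_of_all _ fun r => ?_
        rw [norm_mul]
        gcongr
        · rw [Real.norm_of_nonneg (hφ0 _)]; exact hφC _
        · rw [Real.norm_of_nonneg (NNReal.coe_nonneg _)]
          exact NNReal.coe_le_coe.2 (BoundedContinuousFunction.NNReal.upper_bound G _)
      · refine ae_of_all _ fun r => ?_
        have h1 : Continuous fun u => F r + e.symm u := by fun_prop
        exact (hφ.comp h1).mul (NNReal.continuous_coe.comp (G.continuous.comp ((hU r).comp h1)))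
    have hae : Ψ =ᵐ[lam] Φ := by
      refine ae_eq_of_forall_setLIntegral_eq_of_sigmaFinite hΨc.measurable hΦc.measurable
        fun s hs _ => ?_
      have h1 := hlaw (s.indicator 1) (fun w => G w) (measurable_one.indicator hs)
        (measurable_coe_nnreal_ennreal.comp G.continuous.measurable)
      have h2 : ∀ r, ∫⁻ b, ENNReal.ofReal (φ b) *
          (s.indicator 1 (M (b - F r)) * (G (U r b) : ℝ≥0∞)) ∂lam =
          ENNReal.ofReal |M.det|⁻¹ * ∫⁻ u, s.indicator 1 u *
            (ENNReal.ofReal (φ (F r + e.symm u)) * G (U r (F r + e.symm u))) ∂lam := by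
        intro r
        rw [lintegral_comp_sub_continuousLinearMap lam M hM (F r)]
        congr 1
        refine lintegral_congr fun u => ?_
        have : M (F r + e.symm u - F r) = u := by
          rw [add_sub_cancel_left]
          exact (M.toContinuousLinearEquivOfDetNeZero_apply hM _).symm.trans (e.apply_symm_apply u)
        rw [← he, this]; ring
      have hmeas : Measurable fun p : R × B => s.indicator (1 : B → ℝ≥0∞) p.2 *
            (ENNReal.ofReal (φ (F p.1 + e.symm p.2)) * G (U p.1 (F p.1 + e.symm p.2))) := by
        have h3 : Measurable fun p : R × B => F p.1 + e.symm p.2 :=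
          (hF.comp measurable_fst).add (e.symm.continuous.measurable.comp measurable_snd)
        refine ((measurable_one.indicator hs).comp measurable_snd).mul
          ((ENNReal.measurable_ofReal.comp (hφ.measurable.comp h3)).mul ?_)
        exact measurable_coe_nnreal_ennreal.comp (G.continuous.measurable.comp
          (hUm.comp (measurable_fst.prodMk h3)))
      simp_rw [h2] at h1
      rw [lintegral_const_mul' _ _ ENNReal.ofReal_ne_top,
        lintegral_lintegral_swap hmeas.aemeasurable] at h1
      have h4 : ∀ u, ∫⁻ r, s.indicator (1 : B → ℝ≥0∞) u *
            (ENNReal.ofReal (φ (F r + e.symm u)) * G (U r (F r + e.symm u))) ∂ν =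
          s.indicator Ψ u := by
        intro u
        by_cases hu : u ∈ s <;> simp [hu, hΨ]
      simp_rw [h4] at h1
      rw [lintegral_indicator hs] at h1
      have h5 : ENNReal.ofReal |M.det| * ENNReal.ofReal |M.det|⁻¹ = 1 := by
        rw [← ENNReal.ofReal_mul hdet.le, mul_inv_cancel₀ hdet.ne', ENNReal.ofReal_one]
      rw [← one_mul (∫⁻ u in s, Ψ u ∂lam), ← h5, mul_assoc, h1]
      simp only [hΦ]
      rw [lintegral_mul_const' _ _ hGfin, lintegral_const_mul' _ _ ENNReal.ofReal_ne_top,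
        ← lintegral_indicator hs, mul_assoc]
      congr 3
      ext u
      by_cases hu : u ∈ s <;> simp [hu]
    have := congrFun ((hΨc.ae_eq_iff_eq lam hΦc).1 hae) 0
    simpa [hΨ, hΦ] using this
  -- equality of the two measures on `W`
  have hUF0 : Measurable fun r => U r (F r) := hUm.comp (measurable_id.prodMk hF)
  have hφF : Measurable fun r => ENNReal.ofReal (φ (F r)) :=
    ENNReal.measurable_ofReal.comp (hφ.measurable.comp hF)
  set m₁ : Measure W := (ν.withDensity fun r => ENNReal.ofReal (φ (F r))).map fun r => U r (F r)
  set m₂ : Measure W := (ENNReal.ofReal |M.det| * ENNReal.ofReal (ψ 0)) • κ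
  have hm₁ : ∀ G : W → ℝ≥0∞, Measurable G →
      ∫⁻ w, G w ∂m₁ = ∫⁻ r, ENNReal.ofReal (φ (F r)) * G (U r (F r)) ∂ν := fun G hG => by
    rw [lintegral_map hG hUF0]
    exact lintegral_withDensity_eq_lintegral_mul _ hφF (hG.comp hUF0)
  have hm₂ : ∀ G : W → ℝ≥0∞,
      ∫⁻ w, G w ∂m₂ = ENNReal.ofReal |M.det| * ENNReal.ofReal (ψ 0) * ∫⁻ w, G w ∂κ := fun G => by
    rw [lintegral_smul_measure, smul_eq_mul]
  have : IsFiniteMeasure m₁ := by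
    refine ⟨?_⟩
    rw [← lintegral_one, hm₁ _ measurable_const]
    calc ∫⁻ r, ENNReal.ofReal (φ (F r)) * 1 ∂ν ≤ ∫⁻ r, ENNReal.ofReal C ∂ν := by
          gcongr with r
          rw [mul_one]; exact ENNReal.ofReal_le_ofReal (hφC _)
      _ < ∞ := by simp
  have : IsFiniteMeasure m₂ := ⟨by
    rw [Measure.smul_apply, smul_eq_mul]
    exact ENNReal.mul_lt_top (ENNReal.mul_lt_top ENNReal.ofReal_lt_top ENNReal.ofReal_lt_top)
      (measure_lt_top κ _)⟩
  have hm : m₁ = m₂ := by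
    refine ext_of_forall_lintegral_eq_of_IsFiniteMeasure fun G => ?_
    rw [hm₁ (fun w => G w) (measurable_coe_nnreal_ennreal.comp G.continuous.measurable), hm₂]
    exact key G
  rw [← hm₁ G hG, hm, hm₂]

end ConditionalDensity

/-! ### Laws of linear images of independent Gaussian variables -/

section GaussianLaws

open scoped ENNReal NNReal

theorem charFunDual_gaussianReal_zero (v : ℝ≥0) (L : StrongDual ℝ ℝ) :
    charFunDual (gaussianReal 0 v) L = Complex.exp (-(v * (L 1) ^ 2 / 2 : ℝ)) := by
  have hL : L = L 1 • (1 : StrongDual ℝ ℝ) := by ext; simp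
  have h1 : (gaussianReal 0 v).map (1 : StrongDual ℝ ℝ) = gaussianReal 0 v := by
    have : ((1 : StrongDual ℝ ℝ) : ℝ → ℝ) = id := by ext; simp
    rw [this, Measure.map_id]
  conv_lhs => rw [hL]
  rw [← charFun_map_eq_charFunDual_smul, h1, charFun_gaussianReal]
  congr 1; push_cast; ring

theorem charFunDual_pi_gaussianReal {ι : Type*} [Fintype ι] [DecidableEq ι] (v : ι → ℝ≥0)
    (L : StrongDual ℝ (ι → ℝ)) :
    charFunDual (Measure.pi fun i => gaussianReal 0 (v i)) L =
      Complex.exp (-((∑ i, v i * (L (Pi.single i 1)) ^ 2) / 2 : ℝ)) := by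
  rw [charFunDual_pi]
  simp_rw [charFunDual_gaussianReal_zero]
  rw [← Complex.exp_sum]
  congr 1
  simp [Finset.sum_div]

/-- The linear form `c ↦ ∑ i, c i * A i` on the coefficient space. -/
def linForm {ι : Type*} [Fintype ι] (A : ι → ℝ) : StrongDual ℝ (ι → ℝ) :=
  ∑ i, A i • ContinuousLinearMap.proj i

theorem linForm_apply {ι : Type*} [Fintype ι] (A c : ι → ℝ) :
    linForm A c = ∑ i, c i * A i := by
  simp [linForm, mul_comm]

theorem linForm_single {ι : Type*} [Fintype ι] [DecidableEq ι] (A : ι → ℝ) (i : ι) :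
    linForm A (Pi.single i 1) = A i := by
  simp [linForm_apply, Pi.single_apply]

theorem map_pi_gaussianReal_pair {ι : Type*} [Fintype ι] (v : ι → ℝ≥0) {X U : ι → ℝ} (S : ℝ≥0)
    (hXX : ∑ i, v i * (X i * X i) = 1) (hXU : ∑ i, v i * (X i * U i) = 0)
    (hUU : ∑ i, v i * (U i * U i) = S) :
    (Measure.pi fun i => gaussianReal 0 (v i)).map (fun c => (linForm X c, linForm U c)) =
      (gaussianReal 0 1).prod (gaussianReal 0 S) := by
  classical
  apply Measure.ext_of_charFunDual
  ext L
  have h : (fun c => (linForm X c, linForm U c)) = (linForm X).prod (linForm U) := rfl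
  rw [h, charFunDual_map, charFunDual_pi_gaussianReal, charFunDual_prod,
    charFunDual_gaussianReal_zero, charFunDual_gaussianReal_zero, ← Complex.exp_add]
  congr 1
  have hL : ∀ p : ℝ × ℝ, L p = L (1, 0) * p.1 + L (0, 1) * p.2 := by
    intro p
    have : p = p.1 • ((1, 0) : ℝ × ℝ) + p.2 • ((0, 1) : ℝ × ℝ) := by ext <;> simp
    conv_lhs => rw [this, map_add, map_smul, map_smul]
    simp [mul_comm]
  have hsum : ∑ i, v i * (L ((linForm X).prod (linForm U) (Pi.single i 1))) ^ 2 =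
      L (1, 0) ^ 2 + S * L (0, 1) ^ 2 := by
    have : ∀ i, v i * (L ((linForm X).prod (linForm U) (Pi.single i 1))) ^ 2 =
        L (1, 0) ^ 2 * (v i * (X i * X i)) + 2 * L (1, 0) * L (0, 1) * (v i * (X i * U i)) +
          L (0, 1) ^ 2 * (v i * (U i * U i)) := by
      intro i
      rw [hL]
      simp only [ContinuousLinearMap.prod_apply, linForm_single]
      ring
    simp_rw [this, Finset.sum_add_distrib, ← Finset.mul_sum, hXX, hXU, hUU]
    ring
  have e1 : (L.comp (.inl ℝ ℝ ℝ)) 1 = L (1, 0) := by simp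
  have e2 : (L.comp (.inr ℝ ℝ ℝ)) 1 = L (0, 1) := by simp
  simp only [ContinuousLinearMap.comp_apply] at e1 e2 ⊢
  rw [hsum, e1, e2]
  push_cast; ring

/-- A standard pair of linear forms and a pair with variances `S` and correlation `ρ`, orthogonal
to it, are independent; the second pair is written in terms of two independent standard
variables, so that the degenerate cases `S = 0` and `ρ ^ 2 = 1` are included. -/
theorem map_pi_gaussianReal_quadruple {ι : Type*} [Fintype ι] (v : ι → ℝ≥0)
    {X Y U V : ι → ℝ} {S ρ : ℝ} (hS : 0 ≤ S) (hρ : ρ ^ 2 ≤ 1)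
    (hXX : ∑ i, v i * (X i * X i) = 1) (hYY : ∑ i, v i * (Y i * Y i) = 1)
    (hXY : ∑ i, v i * (X i * Y i) = 0)
    (hXU : ∑ i, v i * (X i * U i) = 0) (hXV : ∑ i, v i * (X i * V i) = 0)
    (hYU : ∑ i, v i * (Y i * U i) = 0) (hYV : ∑ i, v i * (Y i * V i) = 0)
    (hUU : ∑ i, v i * (U i * U i) = S) (hVV : ∑ i, v i * (V i * V i) = S)
    (hUV : ∑ i, v i * (U i * V i) = S * ρ) :
    (Measure.pi fun i => gaussianReal 0 (v i)).map
        (fun c => ((linForm X c, linForm Y c), (linForm U c, linForm V c))) =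
      ((gaussianReal 0 1).prod (gaussianReal 0 1)).prod
        (((gaussianReal 0 1).prod (gaussianReal 0 1)).map
          fun z : ℝ × ℝ => (√S * z.1, √S * (ρ * z.1 + √(1 - ρ ^ 2) * z.2))) := by
  classical
  set T : ℝ × ℝ →L[ℝ] ℝ × ℝ := (√S • ContinuousLinearMap.fst ℝ ℝ ℝ).prod
    (√S • (ρ • ContinuousLinearMap.fst ℝ ℝ ℝ + √(1 - ρ ^ 2) • ContinuousLinearMap.snd ℝ ℝ ℝ))
    with hT
  have hTf : (fun z : ℝ × ℝ => (√S * z.1, √S * (ρ * z.1 + √(1 - ρ ^ 2) * z.2))) = T := by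
    ext z <;> simp [hT, mul_add]
  have : IsProbabilityMeasure (((gaussianReal 0 1).prod (gaussianReal 0 1)).map T) :=
    Measure.isProbabilityMeasure_map T.continuous.measurable.aemeasurable
  rw [hTf]
  apply Measure.ext_of_charFunDual
  ext L
  set A := ((linForm X).prod (linForm Y)).prod ((linForm U).prod (linForm V)) with hA
  have h : (fun c => ((linForm X c, linForm Y c), (linForm U c, linForm V c))) = A := rfl
  rw [h, charFunDual_map, charFunDual_pi_gaussianReal, charFunDual_prod, charFunDual_map,
    charFunDual_prod, charFunDual_prod]
  simp only [charFunDual_gaussianReal_zero]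
  rw [← Complex.exp_add, ← Complex.exp_add, ← Complex.exp_add]
  congr 1
  set l₁ := L ((1, 0), (0, 0)) with hl₁
  set l₂ := L ((0, 1), (0, 0)) with hl₂
  set l₃ := L ((0, 0), (1, 0)) with hl₃
  set l₄ := L ((0, 0), (0, 1)) with hl₄
  have hL : ∀ x y u w : ℝ, L ((x, y), (u, w)) = l₁ * x + l₂ * y + l₃ * u + l₄ * w := by
    intro x y u w
    have : (((x, y), (u, w)) : (ℝ × ℝ) × (ℝ × ℝ)) = x • ((1, 0), (0, 0)) + y • ((0, 1), (0, 0))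
      + u • ((0, 0), (1, 0)) + w • ((0, 0), (0, 1)) := by
      ext <;> simp
    rw [this]
    simp only [map_add, map_smul, smul_eq_mul]
    ring
  have hsum : ∑ i, v i * (L (A (Pi.single i 1))) ^ 2 =
      l₁ ^ 2 + l₂ ^ 2 + S * l₃ ^ 2 + S * l₄ ^ 2 + 2 * (S * ρ) * l₃ * l₄ := by
    have : ∀ i, v i * (L (A (Pi.single i 1))) ^ 2 =
        l₁ ^ 2 * (v i * (X i * X i)) + l₂ ^ 2 * (v i * (Y i * Y i)) +
        l₃ ^ 2 * (v i * (U i * U i)) + l₄ ^ 2 * (v i * (V i * V i)) +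
        2 * l₁ * l₂ * (v i * (X i * Y i)) + 2 * l₁ * l₃ * (v i * (X i * U i)) +
        2 * l₁ * l₄ * (v i * (X i * V i)) + 2 * l₂ * l₃ * (v i * (Y i * U i)) +
        2 * l₂ * l₄ * (v i * (Y i * V i)) + 2 * l₃ * l₄ * (v i * (U i * V i)) := by
      intro i
      have : A (Pi.single i 1) = ((X i, Y i), (U i, V i)) := by
        simp [hA, linForm_single]
      rw [this, hL]
      ring
    simp_rw [this, Finset.sum_add_distrib, ← Finset.mul_sum, hXX, hYY, hXY, hXU, hXV, hYU, hYV,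
      hUU, hVV, hUV]
    ring
  have hsq : √(1 - ρ ^ 2) ^ 2 = 1 - ρ ^ 2 := Real.sq_sqrt (by linarith)
  have hsS : √S ^ 2 = S := Real.sq_sqrt hS
  have e1 : L (((1, 0) : ℝ × ℝ), (0 : ℝ × ℝ)) = l₁ := rfl
  have e2 : L (((0, 1) : ℝ × ℝ), (0 : ℝ × ℝ)) = l₂ := rfl
  have e3 : T (1, 0) = (√S, √S * ρ) := by simp [hT]
  have e4 : T (0, 1) = (0, √S * √(1 - ρ ^ 2)) := by simp [hT]
  have e5 : L ((0 : ℝ × ℝ), T (1, 0)) = l₃ * √S + l₄ * (√S * ρ) := by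
    rw [e3, ← Prod.mk_zero_zero, hL]; ring
  have e6 : L ((0 : ℝ × ℝ), T (0, 1)) = l₄ * (√S * √(1 - ρ ^ 2)) := by
    rw [e4, ← Prod.mk_zero_zero, hL]; ring
  simp only [ContinuousLinearMap.comp_apply, ContinuousLinearMap.inl_apply,
    ContinuousLinearMap.inr_apply]
  rw [hsum, e1, e2, e5, e6]
  have hfin : l₁ ^ 2 + l₂ ^ 2 + S * l₃ ^ 2 + S * l₄ ^ 2 + 2 * (S * ρ) * l₃ * l₄ =
      l₁ ^ 2 + l₂ ^ 2 + (l₃ * √S + l₄ * (√S * ρ)) ^ 2 + (l₄ * (√S * √(1 - ρ ^ 2))) ^ 2 := by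
    have : (l₃ * √S + l₄ * (√S * ρ)) ^ 2 + (l₄ * (√S * √(1 - ρ ^ 2))) ^ 2 =
      √S ^ 2 * ((l₃ + l₄ * ρ) ^ 2 + l₄ ^ 2 * √(1 - ρ ^ 2) ^ 2) := by ring
    rw [add_assoc (l₁ ^ 2 + l₂ ^ 2) ((l₃ * √S + l₄ * (√S * ρ)) ^ 2), this, hsq, hsS]; ring
  rw [hfin]
  push_cast
  ring

theorem gaussianPDFReal_zero_one (x : ℝ) :
    gaussianPDFReal 0 1 x = (√(2 * Real.pi))⁻¹ * Real.exp (-x ^ 2 / 2) := by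
  simp [gaussianPDFReal]

theorem lintegral_gaussianReal_prod {h : ℝ × ℝ → ℝ≥0∞} (hh : Measurable h) {v w : ℝ≥0}
    (hv : v ≠ 0) (hw : w ≠ 0) :
    ∫⁻ z, h z ∂((gaussianReal 0 v).prod (gaussianReal 0 w)) =
      ∫⁻ z : ℝ × ℝ, h z *
        ENNReal.ofReal (gaussianPDFReal 0 v z.1 * gaussianPDFReal 0 w z.2) := by
  rw [gaussianReal_of_var_ne_zero _ hv, gaussianReal_of_var_ne_zero _ hw,
    prod_withDensity (measurable_gaussianPDF _ _) (measurable_gaussianPDF _ _),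
    lintegral_withDensity_eq_lintegral_mul _ (by fun_prop) hh]
  refine lintegral_congr fun z => ?_
  rw [ENNReal.ofReal_mul (gaussianPDFReal_nonneg _ _ _)]
  simp [gaussianPDF, mul_comm]

theorem integral_pow_mul_exp_neg_sq_div_two (n : ℕ) :
    ∫ x in Set.Ioi (0 : ℝ), x ^ n * Real.exp (-x ^ 2 / 2) =
      (1 / 2 : ℝ) ^ (-((n : ℝ) + 1) / 2) * (1 / 2) * Real.Gamma (((n : ℝ) + 1) / 2) := by
  rw [← integral_rpow_mul_exp_neg_mul_rpow (p := 2) (q := n) (b := 1 / 2) (by norm_num)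
    (by have := Nat.cast_nonneg (α := ℝ) n; linarith) (by norm_num)]
  refine setIntegral_congr_fun measurableSet_Ioi fun x _ => ?_
  simp only [Real.rpow_natCast, Real.rpow_ofNat]
  congr 2; ring

theorem integral_id_mul_exp_neg_sq_div_two :
    ∫ x in Set.Ioi (0 : ℝ), x * Real.exp (-x ^ 2 / 2) = 1 := by
  have := integral_pow_mul_exp_neg_sq_div_two 1
  norm_num [Real.rpow_neg_one] at this
  simpa [neg_div] using this

theorem integral_cube_mul_exp_neg_sq_div_two :
    ∫ x in Set.Ioi (0 : ℝ), x ^ 3 * Real.exp (-x ^ 2 / 2) = 2 := by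
  have := integral_pow_mul_exp_neg_sq_div_two 3
  norm_num [Real.Gamma_two] at this
  rw [this]

end GaussianLaws

/-! ### Absolute moments of Gaussian pairs -/

section AbsoluteMoments

open scoped ENNReal NNReal
open Set Real

theorem integral_abs_cos_add_cos {α : ℝ} (h0 : 0 ≤ α) (hπ : α ≤ π) :
    ∫ ψ in (0 : ℝ)..π, |cos α + cos ψ| = 2 * (sin α + (π / 2 - α) * cos α) := by
  have hint : ∀ a b : ℝ, IntervalIntegrable (fun ψ => |cos α + cos ψ|) volume a b :=
    fun a b => Continuous.intervalIntegrable (by fun_prop) a b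
  rw [← intervalIntegral.integral_add_adjacent_intervals (hint 0 (π - α)) (hint (π - α) π)]
  have h1 : ∫ ψ in (0 : ℝ)..(π - α), |cos α + cos ψ| = ∫ ψ in (0 : ℝ)..(π - α), (cos α + cos ψ) := by
    refine intervalIntegral.integral_congr fun ψ hψ => ?_
    rw [uIcc_of_le (by linarith)] at hψ
    have := cos_le_cos_of_nonneg_of_le_pi hψ.1 (by linarith) hψ.2
    rw [cos_pi_sub] at this
    exact abs_of_nonneg (by linarith)
  have h2 : ∫ ψ in (π - α)..π, |cos α + cos ψ| = ∫ ψ in (π - α)..π, -(cos α + cos ψ) := by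
    refine intervalIntegral.integral_congr fun ψ hψ => ?_
    rw [uIcc_of_le (by linarith)] at hψ
    have := cos_le_cos_of_nonneg_of_le_pi (by linarith) hψ.2 hψ.1
    rw [cos_pi_sub] at this
    exact abs_of_nonpos (by linarith)
  have hc : ∀ a b : ℝ, IntervalIntegrable cos volume a b :=
    fun a b => continuous_cos.intervalIntegrable a b
  have hk : ∀ a b : ℝ, IntervalIntegrable (fun _ => cos α) volume a b :=
    fun a b => continuous_const.intervalIntegrable a b
  rw [h1, h2, intervalIntegral.integral_neg, intervalIntegral.integral_add (hk _ _) (hc _ _),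
    intervalIntegral.integral_add (hk _ _) (hc _ _)]
  simp only [intervalIntegral.integral_const, integral_cos, smul_eq_mul, sin_pi, sin_zero,
    sin_pi_sub]
  ring

theorem integral_abs_cos_mul_cos_sub {α : ℝ} (h0 : 0 ≤ α) (hπ : α ≤ π) :
    ∫ φ in (-π)..π, |cos φ * cos (φ - α)| = 2 * (sin α + (π / 2 - α) * cos α) := by
  set f : ℝ → ℝ := fun ψ => |cos α + cos ψ| with hf
  have hint : ∀ a b : ℝ, IntervalIntegrable f volume a b :=
    fun a b => Continuous.intervalIntegrable (by fun_prop) a b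
  have hper : Function.Periodic f (2 * π) := fun x => by simp [hf]
  have h1 : ∀ φ, |cos φ * cos (φ - α)| = (1 / 2) * f (2 * φ - α) := by
    intro φ
    have : cos φ * cos (φ - α) = (1 / 2) * (cos α + cos (2 * φ - α)) := by
      have e1 : cos α = cos (φ - (φ - α)) := by ring_nf
      have e2 : cos (2 * φ - α) = cos (φ + (φ - α)) := by ring_nf
      have e3 := cos_sub φ (φ - α)
      have e4 := cos_add φ (φ - α)
      rw [e1, e2, e3, e4]; ring
    rw [this, abs_mul]; norm_num [hf]
  simp_rw [h1]
  rw [intervalIntegral.integral_const_mul,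
    intervalIntegral.integral_comp_mul_sub (f := f) (hc := two_ne_zero)]
  have h2 : ∀ a, ∫ x in a..(a + 2 * π), f x = 2 * ∫ ψ in (0 : ℝ)..π, f ψ := by
    intro a
    rw [hper.intervalIntegral_add_eq a (-π), show -π + 2 * π = π by ring,
      ← intervalIntegral.integral_add_adjacent_intervals (hint (-π) 0) (hint 0 π)]
    have : ∫ ψ in (-π)..0, f ψ = ∫ ψ in (0 : ℝ)..π, f ψ := by
      rw [← neg_zero, ← intervalIntegral.integral_comp_neg]
      simp [hf]
    rw [this]; ring
  have h3 : ∫ x in (2 * -π - α)..(2 * π - α), f x = 4 * ∫ ψ in (0 : ℝ)..π, f ψ := by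
    rw [← intervalIntegral.integral_add_adjacent_intervals (hint _ (-α)) (hint (-α) _)]
    have e1 := h2 (2 * -π - α)
    have e2 := h2 (-α)
    rw [show 2 * -π - α + 2 * π = -α by ring] at e1
    rw [show -α + 2 * π = 2 * π - α by ring] at e2
    rw [e1, e2]; ring
  rw [h3, integral_abs_cos_add_cos h0 hπ, smul_eq_mul]; ring

/-- The mean of `|U * V|` for a standard Gaussian pair of correlation `ρ`, computed in polar
coordinates: with `ρ = cos α` the angular factor is `|cos φ * cos (φ - α)|`. -/
theorem lintegral_abs_mul_gaussian {ρ : ℝ} (hρ : ρ ^ 2 ≤ 1) :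
    ∫⁻ z : ℝ × ℝ, ENNReal.ofReal |z.1 * (ρ * z.1 + √(1 - ρ ^ 2) * z.2)|
        ∂((gaussianReal 0 1).prod (gaussianReal 0 1)) =
      ENNReal.ofReal (2 / π * (√(1 - ρ ^ 2) + ρ * arcsin ρ)) := by
  have hρ' : |ρ| ≤ 1 := (sq_le_one_iff_abs_le_one ρ).1 hρ
  obtain ⟨hρ1, hρ2⟩ := abs_le.1 hρ'
  set α := arccos ρ with hα
  have hcos : cos α = ρ := cos_arccos hρ1 hρ2
  have hsin : sin α = √(1 - ρ ^ 2) := sin_arccos ρ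
  rw [lintegral_gaussianReal_prod (by fun_prop) one_ne_zero one_ne_zero,
    ← lintegral_comp_polarCoord_symm]
  have hcongr : ∀ p ∈ polarCoord.target, ENNReal.ofReal p.1 •
      (ENNReal.ofReal |(polarCoord.symm p).1 * (ρ * (polarCoord.symm p).1 +
        √(1 - ρ ^ 2) * (polarCoord.symm p).2)| *
        ENNReal.ofReal (gaussianPDFReal 0 1 (polarCoord.symm p).1 *
          gaussianPDFReal 0 1 (polarCoord.symm p).2)) =
      ENNReal.ofReal (p.1 ^ 3 * exp (-p.1 ^ 2 / 2)) *
        ENNReal.ofReal ((2 * π)⁻¹ * |cos p.2 * cos (p.2 - α)|) := by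
    rintro ⟨r, φ⟩ hp
    have hr : 0 < r := hp.1
    simp only [polarCoord_symm_apply, smul_eq_mul, gaussianPDFReal_zero_one]
    rw [← ENNReal.ofReal_mul (abs_nonneg _), ← ENNReal.ofReal_mul hr.le,
      ← ENNReal.ofReal_mul (by positivity)]
    congr 1
    have e1 : r * cos φ * (ρ * (r * cos φ) + √(1 - ρ ^ 2) * (r * sin φ)) =
        r ^ 2 * (cos φ * cos (φ - α)) := by
      rw [cos_sub, hcos, hsin]; ring
    have e2 : (√(2 * π))⁻¹ * exp (-(r * cos φ) ^ 2 / 2) *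
        ((√(2 * π))⁻¹ * exp (-(r * sin φ) ^ 2 / 2)) = (2 * π)⁻¹ * exp (-r ^ 2 / 2) := by
      have : exp (-r ^ 2 / 2) = exp (-(r * cos φ) ^ 2 / 2) * exp (-(r * sin φ) ^ 2 / 2) := by
        rw [← exp_add]; congr 1
        have := sin_sq_add_cos_sq φ
        linear_combination (r ^ 2 / 2) * this
      rw [this]
      have h2 : (√(2 * π))⁻¹ * (√(2 * π))⁻¹ = (2 * π)⁻¹ := by
        rw [← mul_inv, mul_self_sqrt (by positivity)]
      linear_combination (exp (-(r * cos φ) ^ 2 / 2) * exp (-(r * sin φ) ^ 2 / 2)) * h2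
    rw [e1, e2, abs_mul, abs_of_nonneg (sq_nonneg r)]
    ring
  rw [setLIntegral_congr_fun polarCoord.open_target.measurableSet hcongr]
  have htarget : polarCoord.target = Ioi (0 : ℝ) ×ˢ Ioo (-π) π := rfl
  rw [htarget, Measure.volume_eq_prod, ← Measure.prod_restrict,
    lintegral_prod_mul (f := fun r => ENNReal.ofReal (r ^ 3 * exp (-r ^ 2 / 2)))
      (g := fun φ => ENNReal.ofReal ((2 * π)⁻¹ * |cos φ * cos (φ - α)|))
      (by fun_prop) (by fun_prop)]
  have hr : ∫⁻ r in Ioi (0 : ℝ), ENNReal.ofReal (r ^ 3 * exp (-r ^ 2 / 2)) = ENNReal.ofReal 2 := by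
    have e := ofReal_integral_eq_lintegral_ofReal (μ := volume.restrict (Ioi (0 : ℝ)))
      (f := fun r => r ^ 3 * exp (-r ^ 2 / 2)) ?_ ?_
    · rw [← e, integral_cube_mul_exp_neg_sq_div_two]
    · by_contra h
      have := integral_cube_mul_exp_neg_sq_div_two
      rw [integral_undef h] at this
      norm_num at this
    · refine (ae_restrict_mem measurableSet_Ioi).mono fun r hr => ?_
      have : (0 : ℝ) < r := hr
      simp only [Pi.zero_apply]
      positivity
  have hφ : ∫⁻ φ in Ioo (-π) π, ENNReal.ofReal ((2 * π)⁻¹ * |cos φ * cos (φ - α)|) =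
      ENNReal.ofReal ((2 * π)⁻¹ * (2 * (sin α + (π / 2 - α) * cos α))) := by
    rw [← integral_abs_cos_mul_cos_sub (arccos_nonneg ρ) (arccos_le_pi ρ),
      ← intervalIntegral.integral_const_mul,
      intervalIntegral.integral_of_le (by linarith [pi_pos]), restrict_Ioo_eq_restrict_Ioc,
      ofReal_integral_eq_lintegral_ofReal]
    · exact (Continuous.integrableOn_Ioc (by fun_prop))
    · exact ae_of_all _ fun φ => by positivity
  rw [hr, hφ, ← ENNReal.ofReal_mul zero_le_two]
  congr 1
  rw [hsin, hcos, hα, arccos_eq_pi_div_two_sub_arcsin]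
  field_simp
  ring

theorem lintegral_abs_gaussianReal (S : ℝ≥0) :
    ∫⁻ x, ENNReal.ofReal |x| ∂(gaussianReal 0 S) = ENNReal.ofReal (√S * √(2 / π)) := by
  have hmap : gaussianReal 0 S = (gaussianReal 0 1).map (fun x => √S * x) := by
    rw [gaussianReal_map_const_mul]
    congr 1
    · simp
    · ext; simp
  rw [hmap, lintegral_map (by fun_prop) (by fun_prop)]
  simp_rw [abs_mul, ENNReal.ofReal_mul (abs_nonneg _), abs_of_nonneg (sqrt_nonneg (S : ℝ))]
  rw [lintegral_const_mul _ (by fun_prop), ENNReal.ofReal_mul (sqrt_nonneg _)]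
  congr 1
  rw [gaussianReal_of_var_ne_zero _ one_ne_zero,
    lintegral_withDensity_eq_lintegral_mul _ (by fun_prop) (by fun_prop)]
  have hint : Integrable fun x : ℝ => |x| * exp (-|x| ^ 2 / 2) := by
    refine (integrable_mul_exp_neg_mul_sq (b := 1 / 2) (by norm_num)).abs.congr
      (ae_of_all _ fun x => ?_)
    simp only [abs_mul, abs_exp, sq_abs]
    congr 2; ring
  have hval : ∫ x : ℝ, |x| * exp (-|x| ^ 2 / 2) = 2 := by
    rw [integral_comp_abs (f := fun x => x * exp (-x ^ 2 / 2)),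
      integral_id_mul_exp_neg_sq_div_two]
    norm_num
  have : ∀ x : ℝ, (gaussianPDF 0 1 * fun x => ENNReal.ofReal |x|) x =
      ENNReal.ofReal ((√(2 * π))⁻¹ * (|x| * exp (-|x| ^ 2 / 2))) := by
    intro x
    rw [Pi.mul_apply, gaussianPDF, gaussianPDFReal_zero_one, ← ENNReal.ofReal_mul (by positivity),
      sq_abs]
    congr 1; ring
  simp_rw [this]
  rw [← ofReal_integral_eq_lintegral_ofReal (hint.const_mul _)
    (ae_of_all _ fun x => by positivity), integral_const_mul, hval]
  congr 1
  rw [sqrt_mul zero_le_two, sqrt_div zero_le_two]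
  have h2 : √2 * √2 = (2 : ℝ) := mul_self_sqrt zero_le_two
  have : √2 ≠ 0 := by positivity
  have : √π ≠ 0 := by positivity
  field_simp
  linarith

end AbsoluteMoments

/-! ### Regression of the derivatives on the values at two points -/

section GaussianRegression

open scoped ENNReal NNReal

/-- The Cauchy-Schwarz inequality for two linear forms of equal variance. -/
theorem sq_sum_mul_le_sq_of_sum_sq_eq {ι : Type*} [Fintype ι] (v : ι → ℝ≥0) {U V : ι → ℝ} {S : ℝ}
    (hU : ∑ i, v i * (U i * U i) = S) (hV : ∑ i, v i * (V i * V i) = S) :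
    (∑ i, v i * (U i * V i)) ^ 2 ≤ S ^ 2 := by
  have h1 : 0 ≤ ∑ i, v i * ((U i + V i) * (U i + V i)) :=
    Finset.sum_nonneg fun i _ => mul_nonneg (v i).2 (mul_self_nonneg _)
  have h2 : 0 ≤ ∑ i, v i * ((U i - V i) * (U i - V i)) :=
    Finset.sum_nonneg fun i _ => mul_nonneg (v i).2 (mul_self_nonneg _)
  have e1 : ∑ i, v i * ((U i + V i) * (U i + V i)) = 2 * S + 2 * ∑ i, v i * (U i * V i) := by
    calc _ = ∑ i, (v i * (U i * U i) + v i * (V i * V i) + 2 * (v i * (U i * V i))) :=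
          Finset.sum_congr rfl fun i _ => by ring
      _ = _ := by rw [Finset.sum_add_distrib, Finset.sum_add_distrib, hU, hV, ← Finset.mul_sum]; ring
  have e2 : ∑ i, v i * ((U i - V i) * (U i - V i)) = 2 * S - 2 * ∑ i, v i * (U i * V i) := by
    calc _ = ∑ i, (v i * (U i * U i) + v i * (V i * V i) - 2 * (v i * (U i * V i))) :=
          Finset.sum_congr rfl fun i _ => by ring
      _ = _ := by rw [Finset.sum_sub_distrib, Finset.sum_add_distrib, hU, hV, ← Finset.mul_sum]; ring
  rw [e1] at h1
  rw [e2] at h2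
  exact sq_le_sq' (by linarith) (by linarith)

/-- The covariances, with respect to independent variables of variances `v i`, of the values
`e`, `f` and the derivatives `e'`, `f'` of a stationary process of unit variance at two points.
Here `k`, `k₁`, `k₂` are the covariance function and its first two derivatives at the difference
of the points, and `D` is the variance of the derivative. -/
structure IsStationaryGram {ι : Type*} [Fintype ι] (v : ι → ℝ≥0) (e f e' f' : ι → ℝ)
    (D k k₁ k₂ : ℝ) : Prop where
  ee : ∑ i, v i * (e i * e i) = 1
  ff : ∑ i, v i * (f i * f i) = 1
  ef : ∑ i, v i * (e i * f i) = k
  ee' : ∑ i, v i * (e i * e' i) = 0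
  ff' : ∑ i, v i * (f i * f' i) = 0
  fe' : ∑ i, v i * (f i * e' i) = k₁
  ef' : ∑ i, v i * (e i * f' i) = -k₁
  e'e' : ∑ i, v i * (e' i * e' i) = D
  f'f' : ∑ i, v i * (f' i * f' i) = D
  e'f' : ∑ i, v i * (e' i * f' i) = -k₂

namespace IsStationaryGram

variable {ι : Type*} [Fintype ι] {v : ι → ℝ≥0} {e f e' f' : ι → ℝ} {D k k₁ k₂ : ℝ}

theorem sum_mul (h : IsStationaryGram v e f e' f' D k k₁ k₂) (a b p q a' b' p' q' : ℝ) :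
    ∑ i, v i * ((a * e i + b * f i + p * e' i + q * f' i) *
        (a' * e i + b' * f i + p' * e' i + q' * f' i)) =
      a * a' + b * b' + (a * b' + b * a') * k + (b * p' + p * b') * k₁ - (a * q' + q * a') * k₁ +
        (p * p' + q * q') * D - (p * q' + q * p') * k₂ := by
  have : ∀ i, v i * ((a * e i + b * f i + p * e' i + q * f' i) *
        (a' * e i + b' * f i + p' * e' i + q' * f' i)) =
      a * a' * (v i * (e i * e i)) + b * b' * (v i * (f i * f i)) +
      (a * b' + b * a') * (v i * (e i * f i)) + (b * p' + p * b') * (v i * (f i * e' i)) +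
      (a * q' + q * a') * (v i * (e i * f' i)) + p * p' * (v i * (e' i * e' i)) +
      q * q' * (v i * (f' i * f' i)) + (p * q' + q * p') * (v i * (e' i * f' i)) +
      (a * p' + p * a') * (v i * (e i * e' i)) + (b * q' + q * b') * (v i * (f i * f' i)) := by
    intro i; ring
  simp_rw [this, Finset.sum_add_distrib, ← Finset.mul_sum, h.ee, h.ff, h.ef, h.ee', h.ff', h.fe',
    h.ef', h.e'e', h.f'f', h.e'f']
  ring

/-- The second value, made orthogonal to the first one and normalized to unit variance. -/
noncomputable def whitened (e f : ι → ℝ) (k : ℝ) : ι → ℝ := fun i => (f i - k * e i) / √(1 - k ^ 2)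

/-- The derivative at the first point minus its orthogonal projection to the span of the two
values. -/
noncomputable def residualLeft (e f e' : ι → ℝ) (k k₁ : ℝ) : ι → ℝ :=
  fun i => e' i - (k₁ / (1 - k ^ 2)) * (f i - k * e i)

/-- The derivative at the second point minus its orthogonal projection to the span of the two
values. -/
noncomputable def residualRight (e f f' : ι → ℝ) (k k₁ : ℝ) : ι → ℝ :=
  fun i => f' i + (k₁ / (1 - k ^ 2)) * (e i - k * f i)

/-- Gaussian regression: the values are independent of the residuals of the derivatives, which
form a Gaussian pair of common variance `S` and correlation `ρ`. If `S = 0` then `ρ = 0` by the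
convention on division, in agreement with the vanishing of the residual covariance. -/
theorem map_eq (h : IsStationaryGram v e f e' f' D k k₁ k₂) (hk : k ^ 2 < 1) {S ρ : ℝ}
    (hS : S = D - k₁ ^ 2 / (1 - k ^ 2))
    (hρ : ρ = (-k₂ - k * k₁ ^ 2 / (1 - k ^ 2)) / S) :
    0 ≤ S ∧ ρ ^ 2 ≤ 1 ∧
    (Measure.pi fun i => gaussianReal 0 (v i)).map
        (fun c => ((linForm e c, linForm (whitened e f k) c),
          (linForm (residualLeft e f e' k k₁) c, linForm (residualRight e f f' k k₁) c))) =
      ((gaussianReal 0 1).prod (gaussianReal 0 1)).prod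
        (((gaussianReal 0 1).prod (gaussianReal 0 1)).map
          fun z : ℝ × ℝ => (√S * z.1, √S * (ρ * z.1 + √(1 - ρ ^ 2) * z.2))) := by
  have hpos : 0 < 1 - k ^ 2 := by linarith
  have hsq : √(1 - k ^ 2) * √(1 - k ^ 2) = 1 - k ^ 2 := Real.mul_self_sqrt hpos.le
  have hs0 : √(1 - k ^ 2) ≠ 0 := (Real.sqrt_pos.2 hpos).ne'
  have eX : e = fun i => 1 * e i + 0 * f i + 0 * e' i + 0 * f' i := by ext i; ring
  have eY : whitened e f k = fun i => (-k / √(1 - k ^ 2)) * e i + (1 / √(1 - k ^ 2)) * f i +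
      0 * e' i + 0 * f' i := by ext i; simp only [whitened]; ring
  have eU : residualLeft e f e' k k₁ = fun i => (k₁ * k / (1 - k ^ 2)) * e i +
      (-k₁ / (1 - k ^ 2)) * f i + 1 * e' i + 0 * f' i := by
    ext i; simp only [residualLeft]; ring
  have eV : residualRight e f f' k k₁ = fun i => (k₁ / (1 - k ^ 2)) * e i +
      (-(k₁ * k) / (1 - k ^ 2)) * f i + 0 * e' i + 1 * f' i := by
    ext i; simp only [residualRight]; ring
  have hUU : ∑ i, v i * (residualLeft e f e' k k₁ i * residualLeft e f e' k k₁ i) = S := by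
    rw [eU, h.sum_mul, hS]; field_simp; ring
  have hVV : ∑ i, v i * (residualRight e f f' k k₁ i * residualRight e f f' k k₁ i) = S := by
    rw [eV, h.sum_mul, hS]; field_simp; ring
  have hUV : ∑ i, v i * (residualLeft e f e' k k₁ i * residualRight e f f' k k₁ i) =
      -k₂ - k * k₁ ^ 2 / (1 - k ^ 2) := by
    rw [eU, eV, h.sum_mul]; field_simp; ring
  have hS0 : 0 ≤ S := by
    rw [← hUU]
    exact Finset.sum_nonneg fun i _ => mul_nonneg (v i).2 (mul_self_nonneg _)
  have hCS := sq_sum_mul_le_sq_of_sum_sq_eq v hUU hVV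
  rw [hUV] at hCS
  have hρ1 : ρ ^ 2 ≤ 1 := by
    rw [hρ, div_pow]
    exact div_le_one_of_le₀ hCS (sq_nonneg S)
  have hSρ : -k₂ - k * k₁ ^ 2 / (1 - k ^ 2) = S * ρ := by
    rcases hS0.eq_or_lt with h0 | h0
    · rw [← h0] at hCS ⊢
      have := pow_eq_zero_iff (two_ne_zero) |>.1 (le_antisymm (hCS.trans_eq (by ring)) (sq_nonneg _))
      rw [this, zero_mul]
    · rw [hρ, mul_div_cancel₀ _ h0.ne']
  refine ⟨hS0, hρ1, map_pi_gaussianReal_quadruple v hS0 hρ1 h.ee ?_ ?_ ?_ ?_ ?_ ?_ hUU hVV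
    (hUV.trans hSρ)⟩
  · rw [eY, h.sum_mul]; field_simp; rw [sq √(1 - k ^ 2), hsq]; ring
  · nth_rewrite 1 [eX]; rw [eY, h.sum_mul]; field_simp; ring
  · nth_rewrite 1 [eX]; rw [eU, h.sum_mul]; field_simp; ring
  · nth_rewrite 1 [eX]; rw [eV, h.sum_mul]; field_simp; ring
  · rw [eY, eU, h.sum_mul]; field_simp; ring
  · rw [eY, eV, h.sum_mul]; field_simp; ring

end IsStationaryGram

end GaussianRegression

/-! ### The covariance of the process in the angular variable -/

section KostlanCovariance

open scoped ENNReal NNReal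
open Real

/-- The coefficient functions of the process `θ ↦ cos θ ^ d * X (tan θ)`, which has the same zeros
on `(-π / 2, π / 2)` as `X` has on the line, and is stationary. -/
noncomputable def trigWeight (d : ℕ) (θ : ℝ) (n : Fin (d + 1)) : ℝ := cos θ ^ (d - n) * sin θ ^ (n : ℕ)

/-- The derivative of `trigWeight` in the angle. -/
noncomputable def trigWeightDeriv (d : ℕ) (θ : ℝ) (n : Fin (d + 1)) : ℝ := deriv (fun t => trigWeight d t n) θ

theorem hasDerivAt_trigWeight (d : ℕ) (θ : ℝ) (n : Fin (d + 1)) :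
    HasDerivAt (fun t => trigWeight d t n) (trigWeightDeriv d θ n) θ := by
  refine DifferentiableAt.hasDerivAt ?_
  unfold trigWeight
  fun_prop

/-- The variances of the Kostlan-Shub-Smale coefficients. -/
def kssVar (d : ℕ) (n : Fin (d + 1)) : ℝ≥0 := (d.choose n : ℝ≥0)

/-- The covariance function of the process `θ ↦ cos θ ^ d * X (tan θ)`. -/
noncomputable def kssCov (d : ℕ) (τ : ℝ) : ℝ := cos τ ^ d

/-- The derivative of `kssCov d`. The truncated exponent at `d = 0` is harmless because of the
factor `d`. -/
noncomputable def kssCovDeriv (d : ℕ) (τ : ℝ) : ℝ := -(d * cos τ ^ (d - 1) * sin τ)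

/-- The second derivative of `kssCov d`. The truncated exponents for `d ≤ 1` are harmless because
of the factors `d` and `d - 1`. -/
noncomputable def kssCovDeriv₂ (d : ℕ) (τ : ℝ) : ℝ :=
  d * ((d - 1 : ℕ) * cos τ ^ (d - 2) * sin τ ^ 2) - d * (cos τ ^ (d - 1) * cos τ)

theorem hasDerivAt_kssCov (d : ℕ) (τ : ℝ) : HasDerivAt (kssCov d) (kssCovDeriv d τ) τ := by
  have := (hasDerivAt_cos τ).pow d
  refine this.congr_deriv ?_
  rw [kssCovDeriv]; ring

theorem hasDerivAt_kssCovDeriv (d : ℕ) (τ : ℝ) :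
    HasDerivAt (kssCovDeriv d) (kssCovDeriv₂ d τ) τ := by
  have := ((((hasDerivAt_cos τ).pow (d - 1)).mul (hasDerivAt_sin τ)).const_mul (d : ℝ)).neg
  refine (this.congr_deriv ?_).congr_of_eventuallyEq (Eventually.of_forall fun t => ?_)
  · rw [kssCovDeriv₂, show d - 1 - 1 = d - 2 from rfl]; simp only [Pi.pow_apply]; ring
  · simp [kssCovDeriv]; ring

/-- The binomial theorem for `(cos θ * cos φ + sin θ * sin φ) ^ d`. -/
theorem sum_trigWeight_mul (d : ℕ) (θ φ : ℝ) :
    ∑ n, kssVar d n * (trigWeight d θ n * trigWeight d φ n) = kssCov d (θ - φ) := by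
  rw [kssCov, cos_sub, add_comm (cos θ * cos φ), add_pow, Finset.sum_range]
  refine Finset.sum_congr rfl fun n _ => ?_
  simp only [kssVar, trigWeight, NNReal.coe_natCast, mul_pow]
  ring

theorem sum_trigWeightDeriv_mul (d : ℕ) (θ φ : ℝ) :
    ∑ n, kssVar d n * (trigWeightDeriv d θ n * trigWeight d φ n) = kssCovDeriv d (θ - φ) := by
  have h1 : HasDerivAt (fun t => ∑ n, kssVar d n * (trigWeight d t n * trigWeight d φ n))
      (∑ n, kssVar d n * (trigWeightDeriv d θ n * trigWeight d φ n)) θ :=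
    HasDerivAt.fun_sum fun n _ => ((hasDerivAt_trigWeight d θ n).mul_const _).const_mul _
  simp_rw [sum_trigWeight_mul] at h1
  exact h1.unique ((hasDerivAt_kssCov d (θ - φ)).comp_sub_const θ φ)

theorem sum_trigWeightDeriv_mul_trigWeightDeriv (d : ℕ) (θ φ : ℝ) :
    ∑ n, kssVar d n * (trigWeightDeriv d θ n * trigWeightDeriv d φ n) =
      -kssCovDeriv₂ d (θ - φ) := by
  have h1 : HasDerivAt (fun t => ∑ n, kssVar d n * (trigWeightDeriv d θ n * trigWeight d t n))
      (∑ n, kssVar d n * (trigWeightDeriv d θ n * trigWeightDeriv d φ n)) φ :=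
    HasDerivAt.fun_sum fun n _ => ((hasDerivAt_trigWeight d φ n).const_mul _).const_mul _
  simp_rw [sum_trigWeightDeriv_mul] at h1
  exact h1.unique ((hasDerivAt_kssCovDeriv d (θ - φ)).comp_const_sub θ φ)

theorem isStationaryGram_trigWeight (d : ℕ) (θ φ : ℝ) :
    IsStationaryGram (kssVar d) (trigWeight d θ) (trigWeight d φ) (trigWeightDeriv d θ)
      (trigWeightDeriv d φ) d (kssCov d (θ - φ)) (kssCovDeriv d (θ - φ))
      (kssCovDeriv₂ d (θ - φ)) := by
  have hD : -kssCovDeriv₂ d 0 = d := by simp [kssCovDeriv₂]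
  have h0 : kssCovDeriv d 0 = 0 := by simp [kssCovDeriv]
  have h1 : kssCov d 0 = 1 := by simp [kssCov]
  have hsymm : ∀ A B : Fin (d + 1) → ℝ, ∑ n, kssVar d n * (A n * B n) =
      ∑ n, kssVar d n * (B n * A n) := fun A B => Finset.sum_congr rfl fun n _ => by ring
  have hneg : kssCovDeriv d (φ - θ) = -kssCovDeriv d (θ - φ) := by
    rw [← neg_sub θ φ, kssCovDeriv, kssCovDeriv, cos_neg, sin_neg]; ring
  constructor
  · rw [sum_trigWeight_mul, sub_self, h1]
  · rw [sum_trigWeight_mul, sub_self, h1]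
  · rw [sum_trigWeight_mul]
  · rw [hsymm, sum_trigWeightDeriv_mul, sub_self, h0]
  · rw [hsymm, sum_trigWeightDeriv_mul, sub_self, h0]
  · rw [hsymm, sum_trigWeightDeriv_mul]
  · rw [hsymm, sum_trigWeightDeriv_mul, hneg]
  · rw [sum_trigWeightDeriv_mul_trigWeightDeriv, sub_self, hD]
  · rw [sum_trigWeightDeriv_mul_trigWeightDeriv, sub_self, hD]
  · rw [sum_trigWeightDeriv_mul_trigWeightDeriv]

theorem linForm_trigWeight (d : ℕ) {θ : ℝ} (hθ : cos θ ≠ 0) (c : Fin (d + 1) → ℝ) :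
    linForm (trigWeight d θ) c = cos θ ^ d * polyValue c (tan θ) := by
  rw [linForm_apply, polyValue, Finset.mul_sum]
  refine Finset.sum_congr rfl fun n _ => ?_
  rw [trigWeight, tan_eq_sin_div_cos, div_pow, pow_sub₀ _ hθ (Nat.lt_succ_iff.1 n.2)]
  field_simp

theorem hasDerivAt_linForm_trigWeight (d : ℕ) (θ : ℝ) (c : Fin (d + 1) → ℝ) :
    HasDerivAt (fun t => linForm (trigWeight d t) c) (linForm (trigWeightDeriv d θ) c) θ := by
  simp only [linForm_apply]
  exact HasDerivAt.fun_sum fun n _ => (hasDerivAt_trigWeight d θ n).const_mul _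

/-- At a zero, the derivative of `θ ↦ cos θ ^ d * X (tan θ)` involves only the derivative of the
second factor. -/
theorem linForm_trigWeightDeriv_of_zero (d : ℕ) {θ : ℝ} (hθ : cos θ ≠ 0) (c : Fin (d + 1) → ℝ)
    (h0 : polyValue c (tan θ) = 0) {p' : ℝ}
    (hp : HasDerivAt (fun t => polyValue c (tan t)) p' θ) :
    linForm (trigWeightDeriv d θ) c = cos θ ^ d * p' := by
  have h1 := ((hasDerivAt_cos θ).fun_pow d).mul hp
  rw [h0, mul_zero, zero_add] at h1
  refine (hasDerivAt_linForm_trigWeight d θ c).unique (h1.congr_of_eventuallyEq ?_)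
  filter_upwards [continuous_cos.continuousAt.eventually_ne hθ] with t ht
  rw [linForm_trigWeight d ht]; rfl

end KostlanCovariance

/-! ### Separating the lowest coefficients -/

section Splitting

open scoped ENNReal NNReal

theorem lintegral_pi_fin_succ {n : ℕ} (μ : Fin (n + 1) → Measure ℝ) [∀ i, SigmaFinite (μ i)]
    {Φ : (Fin (n + 1) → ℝ) → ℝ≥0∞} (hΦ : Measurable Φ) :
    ∫⁻ c, Φ c ∂(Measure.pi μ) =
      ∫⁻ r, ∫⁻ x, Φ (Fin.cons x r) ∂(μ 0) ∂(Measure.pi fun i : Fin n => μ i.succ) := by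
  have h := measurePreserving_piFinSuccAbove μ 0
  have h2 := h.symm.lintegral_comp hΦ
  rw [← h2, lintegral_prod_symm (fun a => Φ ((MeasurableEquiv.piFinSuccAbove (fun _ => ℝ) 0).symm a))
    (hΦ.comp (MeasurableEquiv.measurable _)).aemeasurable]
  simp only [Fin.succAbove_zero]
  refine lintegral_congr fun r => lintegral_congr fun x => ?_
  congr 1
  exact Fin.insertNth_zero' x r

theorem measurable_fin_cons {n : ℕ} :
    Measurable fun p : ℝ × (Fin n → ℝ) => (Fin.cons p.1 p.2 : Fin (n + 1) → ℝ) := by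
  refine measurable_pi_lambda _ fun i => ?_
  refine Fin.cases ?_ (fun j => ?_) i
  · simpa using measurable_fst
  · simpa [Function.comp_def] using (measurable_pi_apply j).comp measurable_snd

theorem lintegral_pi_gaussianReal_split {n : ℕ} (v : Fin (n + 1) → ℝ≥0) (h0 : v 0 ≠ 0)
    {Φ : (Fin (n + 1) → ℝ) → ℝ≥0∞} (hΦ : Measurable Φ) :
    ∫⁻ c, Φ c ∂(Measure.pi fun i => gaussianReal 0 (v i)) =
      ∫⁻ r, (∫⁻ b : ℝ, Φ (Fin.cons b r) * ENNReal.ofReal (gaussianPDFReal 0 (v 0) b))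
        ∂(Measure.pi fun i : Fin n => gaussianReal 0 (v i.succ)) := by
  rw [lintegral_pi_fin_succ _ hΦ]
  refine lintegral_congr fun r => ?_
  have hm : Measurable fun b : ℝ => Φ (Fin.cons b r) :=
    hΦ.comp (measurable_fin_cons.comp measurable_prodMk_right)
  rw [gaussianReal_of_var_ne_zero _ h0,
    lintegral_withDensity_eq_lintegral_mul _ (measurable_gaussianPDF _ _) hm]
  exact lintegral_congr fun b => mul_comm _ _

theorem lintegral_pi_gaussianReal_split_two {n : ℕ} (v : Fin (n + 2) → ℝ≥0) (h0 : v 0 ≠ 0)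
    (h1 : v 1 ≠ 0) {Φ : (Fin (n + 2) → ℝ) → ℝ≥0∞} (hΦ : Measurable Φ) :
    ∫⁻ c, Φ c ∂(Measure.pi fun i => gaussianReal 0 (v i)) =
      ∫⁻ r, (∫⁻ b : ℝ × ℝ, Φ (Fin.cons b.1 (Fin.cons b.2 r)) *
          ENNReal.ofReal (gaussianPDFReal 0 (v 0) b.1 * gaussianPDFReal 0 (v 1) b.2))
        ∂(Measure.pi fun i : Fin n => gaussianReal 0 (v i.succ.succ)) := by
  rw [lintegral_pi_fin_succ _ hΦ]
  have hm : Measurable fun r : Fin (n + 1) → ℝ =>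
      ∫⁻ x, Φ (Fin.cons x r) ∂(gaussianReal 0 (v 0)) :=
    Measurable.lintegral_prod_left' (f := fun p : ℝ × (Fin (n + 1) → ℝ) => Φ (Fin.cons p.1 p.2))
      (hΦ.comp measurable_fin_cons)
  rw [lintegral_pi_fin_succ (fun i : Fin (n + 1) => gaussianReal 0 (v i.succ)) hm]
  refine lintegral_congr fun r => ?_
  have hm2 : Measurable fun b : ℝ × ℝ => Φ (Fin.cons b.1 (Fin.cons b.2 r)) :=
    hΦ.comp (measurable_fin_cons.comp (measurable_fst.prodMk
      (measurable_fin_cons.comp (measurable_snd.prodMk measurable_const))))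
  have h1' : v (Fin.succ 0) ≠ 0 := h1
  rw [← lintegral_prod_symm (fun b : ℝ × ℝ => Φ (Fin.cons b.1 (Fin.cons b.2 r)))
    hm2.aemeasurable, lintegral_gaussianReal_prod hm2 h0 h1']
  rfl

end Splitting

/-! ### Measurability of the number of real roots -/

section RootCount

open Polynomial

/-- The set of real roots of the polynomial with coefficients `c`. -/
def realZeros {d : ℕ} (c : Fin (d + 1) → ℝ) : Set ℝ := {x | polyValue c x = 0}

theorem polyValue_eq_eval {d : ℕ} (c : Fin (d + 1) → ℝ) (x : ℝ) :
    polyValue c x = (Polynomial.ofFn (d + 1) c).eval x := by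
  rw [Polynomial.eval_eq_sum_range' (n := d + 1) (Polynomial.ofFn_natDegree_lt (by omega) c),
    Finset.sum_range, polyValue]
  refine Finset.sum_congr rfl fun n _ => ?_
  rw [Polynomial.ofFn_coeff_eq_val_of_lt c n.2]

theorem realZeros_finite_and_ncard_le {d : ℕ} {c : Fin (d + 1) → ℝ} (hc : c ≠ 0) :
    (realZeros c).Finite ∧ (realZeros c).ncard ≤ d := by
  have hp : Polynomial.ofFn (d + 1) c ≠ 0 := fun h => hc <| by
    ext n
    rw [← Polynomial.ofFn_coeff_eq_val_of_lt c n.2, h]; simp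
  have hsub : realZeros c = ((Polynomial.ofFn (d + 1) c).roots.toFinset : Set ℝ) := by
    ext x
    simp [realZeros, polyValue_eq_eval, hp]
  rw [hsub]
  refine ⟨Finset.finite_toSet _, ?_⟩
  rw [Set.ncard_coe_finset]
  have h1 := (Multiset.toFinset_card_le (Polynomial.ofFn (d + 1) c).roots).trans
    (Polynomial.card_roots' _)
  have := Polynomial.ofFn_natDegree_lt (n := d + 1) (by omega) c
  omega

theorem polyValue_continuous {d : ℕ} :
    Continuous fun p : (Fin (d + 1) → ℝ) × ℝ => polyValue p.1 p.2 := by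
  unfold polyValue; fun_prop

/-- The set of polynomials with at least `m` roots is the projection of the set of pairs formed
by a polynomial and `m` distinct roots of it. The latter is the intersection of an open and a
closed set, hence σ-compact, so the projection is σ-compact too, and in particular measurable. -/
theorem measurableSet_le_encard_realZeros (d m : ℕ) :
    MeasurableSet {c : Fin (d + 1) → ℝ | (m : ℕ∞) ≤ (realZeros c).encard} := by
  set U : Set ((Fin (d + 1) → ℝ) × (Fin m → ℝ)) := {p | ∀ i j, i ≠ j → p.2 i ≠ p.2 j} with hU
  set Z : Set ((Fin (d + 1) → ℝ) × (Fin m → ℝ)) := {p | ∀ i, polyValue p.1 (p.2 i) = 0} with hZ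
  have hUo : IsOpen U := by
    simp only [hU, Set.ofPred_forall]
    refine isOpen_iInter_of_finite fun i => isOpen_iInter_of_finite fun j =>
      isOpen_iInter_of_finite fun _ => isOpen_ne_fun (by fun_prop) (by fun_prop)
  have hZc : IsClosed Z := by
    simp only [hZ, Set.ofPred_forall]
    refine isClosed_iInter fun i => isClosed_eq ?_ continuous_const
    exact polyValue_continuous.comp (continuous_fst.prodMk ((continuous_apply i).comp continuous_snd))
  have himage : {c : Fin (d + 1) → ℝ | (m : ℕ∞) ≤ (realZeros c).encard} =
      Prod.fst '' (U ∩ Z) := by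
    ext c
    simp only [Set.mem_ofPred_eq, Set.mem_image, Set.mem_inter_iff, Prod.exists, exists_and_right,
      exists_eq_right]
    constructor
    · intro h
      obtain ⟨t, ht, htm⟩ := Set.exists_subset_encard_eq h
      have htf : t.Finite := Set.finite_of_encard_eq_coe htm
      have hcard : htf.toFinset.card = m := by
        have := htf.encard_eq_coe_toFinset_card
        rw [htm] at this
        exact_mod_cast this.symm
      refine ⟨fun i => (htf.toFinset.equivFinOfCardEq hcard).symm i, ?_, fun i => ?_⟩
      · intro i j hij h
        exact hij ((htf.toFinset.equivFinOfCardEq hcard).symm.injective (Subtype.ext h))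
      · exact ht (htf.mem_toFinset.1 ((htf.toFinset.equivFinOfCardEq hcard).symm i).2)
    · rintro ⟨x, hx, hxz⟩
      have hinj : Function.Injective x := fun i j h => by
        by_contra hij
        exact hx i j hij h
      calc (m : ℕ∞) = (Set.univ : Set (Fin m)).encard := by simp
        _ = (Set.range x).encard := by rw [← Set.image_univ, hinj.encard_image]
        _ ≤ _ := Set.encard_le_encard (by rintro _ ⟨i, rfl⟩; exact hxz i)
  obtain ⟨F, hFc, -, hFU, -⟩ := hUo.exists_iUnion_isClosed
  have hsc : IsSigmaCompact (Prod.fst '' (U ∩ Z)) := by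
    refine IsSigmaCompact.image (hf := continuous_fst) ?_
    rw [← hFU, Set.iUnion_inter]
    exact isSigmaCompact_iUnion _ fun n => isSigmaCompact_univ.of_isClosed_subset
      ((hFc n).inter hZc) (Set.subset_univ _)
  obtain ⟨K, hK, hKU⟩ := hsc
  rw [himage, ← hKU]
  exact MeasurableSet.iUnion fun n => (hK n).isClosed.measurableSet

theorem measurable_numRealRoots (d : ℕ) :
    Measurable (numRealRoots : (Fin (d + 1) → ℝ) → ℕ) := by
  refine measurable_of_Ici fun m => ?_
  rcases m.eq_zero_or_pos with rfl | hm
  · simp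
  · have : numRealRoots ⁻¹' Set.Ici m =
        {c : Fin (d + 1) → ℝ | (m : ℕ∞) ≤ (realZeros c).encard} \ {0} := by
      ext c
      simp only [Set.mem_preimage, Set.mem_Ici, Set.mem_sdiff, Set.mem_ofPred_eq,
        Set.mem_singleton_iff]
      have hN : numRealRoots c = (realZeros c).ncard := rfl
      by_cases hc : c = 0
      · have : realZeros c = Set.univ := by ext x; simp [realZeros, polyValue, hc]
        rw [hN, this, Set.infinite_univ.ncard]
        simp [hc]; omega
      · rw [hN, ← (realZeros_finite_and_ncard_le hc).1.cast_ncard_eq]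
        simp [hc]
    rw [this]
    exact (measurableSet_le_encard_realZeros d m).diff (measurableSet_singleton 0)

theorem encard_offDiag_of_finite {s : Set ℝ} (hs : s.Finite) :
    s.offDiag.encard = ((s.ncard * s.ncard - s.ncard : ℕ) : ℕ∞) := by
  classical
  obtain ⟨t, rfl⟩ := hs.exists_finset_coe
  rw [← Finset.coe_offDiag, Set.encard_coe_eq_coe_finsetCard, Finset.offDiag_card,
    Set.ncard_coe_finset]

end RootCount

/-! ### The pair of lowest coefficients that produces two given zeros -/

section PairSolution

open scoped ENNReal NNReal
open Real

/-- The linear map of the plane with matrix `!![a, b; c, e]`. -/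
noncomputable def planeMap (a b c e : ℝ) : ℝ × ℝ →L[ℝ] ℝ × ℝ :=
  (a • ContinuousLinearMap.fst ℝ ℝ ℝ + b • ContinuousLinearMap.snd ℝ ℝ ℝ).prod
    (c • ContinuousLinearMap.fst ℝ ℝ ℝ + e • ContinuousLinearMap.snd ℝ ℝ ℝ)

theorem planeMap_apply (a b c e : ℝ) (p : ℝ × ℝ) :
    planeMap a b c e p = (a * p.1 + b * p.2, c * p.1 + e * p.2) := by
  simp [planeMap]

theorem det_planeMap (a b c e : ℝ) : (planeMap a b c e).det = a * e - b * c := by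
  have : ((planeMap a b c e : ℝ × ℝ →L[ℝ] ℝ × ℝ) : ℝ × ℝ →ₗ[ℝ] ℝ × ℝ) =
      Matrix.toLin (Module.Basis.finTwoProd ℝ) (Module.Basis.finTwoProd ℝ) !![a, b; c, e] := by
    apply LinearMap.ext
    intro p
    rw [Matrix.toLin_finTwoProd_apply]
    exact planeMap_apply a b c e p
  rw [ContinuousLinearMap.det, this, LinearMap.det_toLin, Matrix.det_fin_two_of]

/-- The value at `x` of the polynomial whose coefficients from degree `2` on are `r`, the lowest
two being zero. -/
def tailValue {k : ℕ} (r : Fin k → ℝ) (x : ℝ) : ℝ := ∑ n : Fin k, r n * x ^ ((n : ℕ) + 2)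

/-- The derivative of `tailValue r`. -/
def tailDeriv {k : ℕ} (r : Fin k → ℝ) (x : ℝ) : ℝ :=
  ∑ n : Fin k, r n * (((n : ℕ) + 2 : ℝ) * x ^ ((n : ℕ) + 1))

theorem polyValue_cons_cons {k : ℕ} (b₀ b₁ : ℝ) (r : Fin k → ℝ) (x : ℝ) :
    polyValue (d := k + 1) (Fin.cons b₀ (Fin.cons b₁ r)) x = b₀ + b₁ * x + tailValue r x := by
  simp [polyValue, tailValue, Fin.sum_univ_succ, add_assoc]

theorem hasDerivAt_tailValue {k : ℕ} (r : Fin k → ℝ) (x : ℝ) :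
    HasDerivAt (tailValue r) (tailDeriv r x) x := by
  refine HasDerivAt.fun_sum fun n _ => ?_
  have := (hasDerivAt_pow ((n : ℕ) + 2) x).const_mul (r n)
  simpa using this

/-- The derivative at `θ` of the composition with `tan` of the polynomial with linear coefficient
`b₁` and higher coefficients `r`. The constant coefficient does not matter. -/
noncomputable def polyTanDeriv {k : ℕ} (b₁ : ℝ) (r : Fin k → ℝ) (θ : ℝ) : ℝ :=
  (b₁ + tailDeriv r (tan θ)) * (1 / cos θ ^ 2)

theorem hasDerivAt_polyValue_tan {k : ℕ} (b₀ b₁ : ℝ) (r : Fin k → ℝ) {θ : ℝ} (hθ : cos θ ≠ 0) :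
    HasDerivAt (fun t => polyValue (d := k + 1) (Fin.cons b₀ (Fin.cons b₁ r)) (tan t))
      (polyTanDeriv b₁ r θ) θ := by
  simp_rw [polyValue_cons_cons]
  have ht := hasDerivAt_tan hθ
  have := ((ht.const_mul b₁).const_add b₀).add ((hasDerivAt_tailValue r (tan θ)).comp θ ht)
  refine this.congr_deriv ?_
  rw [polyTanDeriv]; ring

/-- The linear coefficient for which the polynomial with higher coefficients `r` takes equal
values at `tan p.1` and `tan p.2`. -/
noncomputable def pairSlope {k : ℕ} (r : Fin k → ℝ) (p : ℝ × ℝ) : ℝ :=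
  -(tailValue r (tan p.1) - tailValue r (tan p.2)) / (tan p.1 - tan p.2)

/-- The constant and the linear coefficient for which the polynomial with higher coefficients `r`
vanishes at `tan p.1` and `tan p.2`. -/
noncomputable def pairSolution {k : ℕ} (r : Fin k → ℝ) (p : ℝ × ℝ) : ℝ × ℝ :=
  (-tailValue r (tan p.1) - pairSlope r p * tan p.1, pairSlope r p)

/-- The derivative of `pairSolution r` at a pair of distinct angles. Moving one zero tilts the
line through the other. -/
noncomputable def pairSolutionDeriv {k : ℕ} (r : Fin k → ℝ) (p : ℝ × ℝ) : ℝ × ℝ →L[ℝ] ℝ × ℝ :=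
  let s₁ := -polyTanDeriv (pairSlope r p) r p.1 / (tan p.1 - tan p.2)
  let s₂ := polyTanDeriv (pairSlope r p) r p.2 / (tan p.1 - tan p.2)
  planeMap (-tan p.2 * s₁) (-tan p.1 * s₂) s₁ s₂

theorem det_pairSolutionDeriv {k : ℕ} (r : Fin k → ℝ) (p : ℝ × ℝ) :
    (pairSolutionDeriv r p).det = -(polyTanDeriv (pairSlope r p) r p.1 *
      polyTanDeriv (pairSlope r p) r p.2) / (tan p.1 - tan p.2) := by
  rw [pairSolutionDeriv, det_planeMap]
  rcases eq_or_ne (tan p.1 - tan p.2) 0 with h | h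
  · simp [h]
  · field_simp; ring

/-- The pairs of distinct angles in `(-π / 2, π / 2)`. -/
def anglePairs : Set (ℝ × ℝ) :=
  (Set.Ioo (-(π / 2)) (π / 2) ×ˢ Set.Ioo (-(π / 2)) (π / 2)) ∩ {p | p.1 ≠ p.2}

theorem measurableSet_anglePairs : MeasurableSet anglePairs :=
  (measurableSet_Ioo.prod measurableSet_Ioo).inter
    (measurableSet_eq_fun measurable_fst measurable_snd).compl

theorem tan_sub_tan_ne_zero {p : ℝ × ℝ} (hp : p ∈ anglePairs) : tan p.1 - tan p.2 ≠ 0 :=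
  fun h => hp.2 (injOn_tan hp.1.1 hp.1.2 (sub_eq_zero.1 h))

theorem hasFDerivAt_pairSolution {k : ℕ} (r : Fin k → ℝ) {p : ℝ × ℝ} (hp : p ∈ anglePairs) :
    HasFDerivAt (pairSolution r) (pairSolutionDeriv r p) p := by
  have hΔ := tan_sub_tan_ne_zero hp
  have hc1 := (cos_pos_of_mem_Ioo hp.1.1).ne'
  have hc2 := (cos_pos_of_mem_Ioo hp.1.2).ne'
  have hf : HasFDerivAt (fun z : ℝ × ℝ => z.1) (ContinuousLinearMap.fst ℝ ℝ ℝ) p :=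
    hasFDerivAt_fst
  have hs : HasFDerivAt (fun z : ℝ × ℝ => z.2) (ContinuousLinearMap.snd ℝ ℝ ℝ) p :=
    hasFDerivAt_snd
  have hT1 := (hasDerivAt_tan hc1).comp_hasFDerivAt p hf
  have hT2 := (hasDerivAt_tan hc2).comp_hasFDerivAt p hs
  have hq1 := (hasDerivAt_tailValue r (tan p.1)).comp_hasFDerivAt p hT1
  have hq2 := (hasDerivAt_tailValue r (tan p.2)).comp_hasFDerivAt p hT2
  have hslope := (hq1.sub hq2).neg.mul ((hasDerivAt_inv hΔ).comp_hasFDerivAt p (hT1.sub hT2))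
  have hF := (hq1.neg.sub (hslope.mul hT1)).prodMk hslope
  refine (hF.congr_fderiv ?_).congr_of_eventuallyEq (Eventually.of_forall fun z => ?_)
  · have hslope : pairSlope r p =
        -(tailValue r (tan p.1) - tailValue r (tan p.2)) / (tan p.1 - tan p.2) := rfl
    apply ContinuousLinearMap.ext
    rintro ⟨x, y⟩
    simp only [pairSolutionDeriv, planeMap_apply, polyTanDeriv, hslope]
    simp [ContinuousLinearMap.prod_apply]
    constructor <;> field_simp <;> ring
  · simp [pairSolution, pairSlope, div_eq_mul_inv]

theorem polyValue_pairSolution {k : ℕ} (r : Fin k → ℝ) {p : ℝ × ℝ} (hp : p ∈ anglePairs) :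
    polyValue (d := k + 1) (Fin.cons (pairSolution r p).1 (Fin.cons (pairSolution r p).2 r))
        (tan p.1) = 0 ∧
    polyValue (d := k + 1) (Fin.cons (pairSolution r p).1 (Fin.cons (pairSolution r p).2 r))
        (tan p.2) = 0 := by
  have hΔ := tan_sub_tan_ne_zero hp
  simp only [polyValue_cons_cons, pairSolution, pairSlope]
  constructor
  · ring
  · field_simp; ring

/-- The fibres of `pairSolution r` are the ordered pairs of distinct real roots. -/
theorem encard_inter_pairSolution_fiber {k : ℕ} (r : Fin k → ℝ) (b : ℝ × ℝ) :
    (anglePairs ∩ pairSolution r ⁻¹' {b}).encard =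
      (realZeros (d := k + 1) (Fin.cons b.1 (Fin.cons b.2 r))).offDiag.encard := by
  have hinj : Set.InjOn (fun p : ℝ × ℝ => (tan p.1, tan p.2))
      (anglePairs ∩ pairSolution r ⁻¹' {b}) := by
    intro p hp q hq h
    rw [Prod.ext_iff] at h
    exact Prod.ext (injOn_tan hp.1.1.1 hq.1.1.1 h.1) (injOn_tan hp.1.1.2 hq.1.1.2 h.2)
  rw [← hinj.encard_image]
  congr 1
  ext ⟨x, y⟩
  simp only [Set.mem_image, Set.mem_inter_iff, Set.mem_preimage, Set.mem_singleton_iff,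
    Set.mem_offDiag, Prod.mk.injEq]
  constructor
  · rintro ⟨p, ⟨hp, rfl⟩, rfl, rfl⟩
    have := polyValue_pairSolution r hp
    exact ⟨this.1, this.2, fun h => tan_sub_tan_ne_zero hp (sub_eq_zero.2 h)⟩
  · rintro ⟨hx, hy, hxy⟩
    refine ⟨(arctan x, arctan y), ⟨⟨⟨arctan_mem_Ioo x, arctan_mem_Ioo y⟩,
      fun h => hxy (arctan_injective h)⟩, ?_⟩, tan_arctan x, tan_arctan y⟩
    have hx' : b.1 + b.2 * x + tailValue r x = 0 := by
      rw [← polyValue_cons_cons]; exact hx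
    have hy' : b.1 + b.2 * y + tailValue r y = 0 := by
      rw [← polyValue_cons_cons]; exact hy
    have hxy' : x - y ≠ 0 := sub_ne_zero.2 hxy
    have hslope : pairSlope r (arctan x, arctan y) = b.2 := by
      simp only [pairSlope, tan_arctan]
      rw [div_eq_iff hxy']
      linear_combination hy' - hx'
    rw [Prod.ext_iff, pairSolution]
    simp only [hslope, tan_arctan, and_true]
    linear_combination -hx'

theorem measurable_tan : Measurable tan := by
  have : tan = fun x => sin x / cos x := funext tan_eq_sin_div_cos
  rw [this]; fun_prop

theorem measurable_tailValue_tan {k : ℕ} {α : Type*} [MeasurableSpace α] {f : α → Fin k → ℝ}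
    {g : α → ℝ} (hf : Measurable f) (hg : Measurable g) :
    Measurable fun a => tailValue (f a) (tan (g a)) := by
  have := measurable_tan.comp hg
  simp only [Function.comp_def] at this
  unfold tailValue
  fun_prop

theorem measurable_polyTanDeriv {k : ℕ} {α : Type*} [MeasurableSpace α] {f : α → Fin k → ℝ}
    {g b : α → ℝ} (hf : Measurable f) (hg : Measurable g) (hb : Measurable b) :
    Measurable fun a => polyTanDeriv (b a) (f a) (g a) := by
  have := measurable_tan.comp hg
  simp only [Function.comp_def] at this
  unfold polyTanDeriv tailDeriv
  fun_prop

theorem measurable_pairSlope {k : ℕ} :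
    Measurable fun z : (Fin k → ℝ) × (ℝ × ℝ) => pairSlope z.1 z.2 := by
  have h1 : Measurable fun z : (Fin k → ℝ) × (ℝ × ℝ) => tan z.2.1 :=
    measurable_tan.comp (by fun_prop)
  have h2 : Measurable fun z : (Fin k → ℝ) × (ℝ × ℝ) => tan z.2.2 :=
    measurable_tan.comp (by fun_prop)
  have h3 : Measurable fun z : (Fin k → ℝ) × (ℝ × ℝ) => tailValue z.1 (tan z.2.1) :=
    measurable_tailValue_tan measurable_fst (by fun_prop)
  have h4 : Measurable fun z : (Fin k → ℝ) × (ℝ × ℝ) => tailValue z.1 (tan z.2.2) :=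
    measurable_tailValue_tan measurable_fst (by fun_prop)
  exact (h3.sub h4).neg.div (h1.sub h2)

theorem measurable_pairSolution {k : ℕ} :
    Measurable fun z : (Fin k → ℝ) × (ℝ × ℝ) => pairSolution z.1 z.2 := by
  have h1 : Measurable fun z : (Fin k → ℝ) × (ℝ × ℝ) => tan z.2.1 :=
    measurable_tan.comp (by fun_prop)
  have h3 : Measurable fun z : (Fin k → ℝ) × (ℝ × ℝ) => tailValue z.1 (tan z.2.1) :=
    measurable_tailValue_tan measurable_fst (by fun_prop)
  exact (h3.neg.sub (measurable_pairSlope.mul h1)).prodMk measurable_pairSlope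

theorem measurable_det_pairSolutionDeriv {k : ℕ} :
    Measurable fun z : (Fin k → ℝ) × (ℝ × ℝ) => (pairSolutionDeriv z.1 z.2).det := by
  simp_rw [det_pairSolutionDeriv]
  have h1 : Measurable fun z : (Fin k → ℝ) × (ℝ × ℝ) => tan z.2.1 :=
    measurable_tan.comp (by fun_prop)
  have h2 : Measurable fun z : (Fin k → ℝ) × (ℝ × ℝ) => tan z.2.2 :=
    measurable_tan.comp (by fun_prop)
  exact ((measurable_polyTanDeriv measurable_fst (measurable_fst.comp measurable_snd)
    measurable_pairSlope).mul (measurable_polyTanDeriv measurable_fst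
      (measurable_snd.comp measurable_snd) measurable_pairSlope)).neg.div (h1.sub h2)

end PairSolution

/-! ### The second factorial moment of the number of real roots -/

section FactorialMoment

open scoped ENNReal NNReal
open Real

/-- The joint law of the Kostlan-Shub-Smale coefficients. -/
noncomputable def kssMeasure (d : ℕ) : Measure (Fin (d + 1) → ℝ) :=
  Measure.pi fun n => gaussianReal 0 (kssVar d n)

instance (d : ℕ) : IsProbabilityMeasure (kssMeasure d) := by
  unfold kssMeasure; infer_instance

/-- The variance of the derivative of the stationary process, given its values at two angles that
differ by `τ`. -/
noncomputable def kssCondVar (d : ℕ) (τ : ℝ) : ℝ :=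
  d - kssCovDeriv d τ ^ 2 / (1 - kssCov d τ ^ 2)

/-- The correlation of the derivatives of the stationary process at two angles that differ by `τ`,
given the values at these angles. -/
noncomputable def kssCondCorr (d : ℕ) (τ : ℝ) : ℝ :=
  (-kssCovDeriv₂ d τ - kssCov d τ * kssCovDeriv d τ ^ 2 / (1 - kssCov d τ ^ 2)) / kssCondVar d τ

/-- The mean of `|U * V|` for a standard Gaussian pair of correlation `ρ`, divided by its value
`2 / π` at `ρ = 0`. -/
noncomputable def absMoment (ρ : ℝ) : ℝ := √(1 - ρ ^ 2) + ρ * arcsin ρ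

theorem absMoment_nonneg (ρ : ℝ) : 0 ≤ absMoment ρ := by
  refine add_nonneg (sqrt_nonneg _) ?_
  rcases le_total 0 ρ with h | h
  · exact mul_nonneg h (arcsin_nonneg.2 h)
  · exact mul_nonneg_of_nonpos_of_nonpos h (arcsin_nonpos.2 h)

/-- The density of the pairs of distinct zeros of the stationary process at angular distance `τ`.
For `τ` in `π ℤ`, where the two values are dependent, it has the irrelevant value `0`. -/
noncomputable def pairDensity (d : ℕ) (τ : ℝ) : ℝ :=
  1 / π ^ 2 * (kssCondVar d τ / √(1 - kssCov d τ ^ 2)) * absMoment (kssCondCorr d τ)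

theorem linForm_smul_sub {ι : Type*} [Fintype ι] (A B : ι → ℝ) (a k : ℝ) (c : ι → ℝ) :
    linForm (fun i => (A i - k * B i) * a) c = (linForm A c - k * linForm B c) * a := by
  simp only [linForm_apply, Finset.mul_sum, ← Finset.sum_sub_distrib, Finset.sum_mul]
  exact Finset.sum_congr rfl fun i _ => by ring

theorem linForm_add_smul_sub {ι : Type*} [Fintype ι] (E A B : ι → ℝ) (a k : ℝ) (c : ι → ℝ) :
    linForm (fun i => E i + a * (A i - k * B i)) c =
      linForm E c + a * (linForm A c - k * linForm B c) := by
  simp only [linForm_apply, Finset.mul_sum, ← Finset.sum_sub_distrib, ← Finset.sum_add_distrib]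
  exact Finset.sum_congr rfl fun i _ => by ring

theorem linForm_whitened {ι : Type*} [Fintype ι] (e f : ι → ℝ) (k : ℝ) (c : ι → ℝ) :
    linForm (IsStationaryGram.whitened e f k) c =
      (linForm f c - k * linForm e c) / √(1 - k ^ 2) := by
  rw [div_eq_mul_inv, ← linForm_smul_sub]; rfl

theorem linForm_residualLeft {ι : Type*} [Fintype ι] (e f e' : ι → ℝ) (k k₁ : ℝ) (c : ι → ℝ) :
    linForm (IsStationaryGram.residualLeft e f e' k k₁) c =
      linForm e' c + -(k₁ / (1 - k ^ 2)) * (linForm f c - k * linForm e c) := by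
  rw [← linForm_add_smul_sub]
  congr 2; ext i; simp only [IsStationaryGram.residualLeft]; ring

theorem linForm_residualRight {ι : Type*} [Fintype ι] (e f f' : ι → ℝ) (k k₁ : ℝ) (c : ι → ℝ) :
    linForm (IsStationaryGram.residualRight e f f' k k₁) c =
      linForm f' c + k₁ / (1 - k ^ 2) * (linForm e c - k * linForm f c) := by
  rw [← linForm_add_smul_sub]; rfl

theorem continuous_fin_cons_cons {k : ℕ} :
    Continuous fun p : (Fin k → ℝ) × (ℝ × ℝ) =>
      (Fin.cons p.2.1 (Fin.cons p.2.2 p.1) : Fin (k + 2) → ℝ) := by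
  refine continuous_pi fun i => ?_
  refine Fin.cases ?_ (fun j => ?_) i
  · simp only [Fin.cons_zero]; fun_prop
  · simp only [Fin.cons_succ]
    refine Fin.cases ?_ (fun j => ?_) j
    · simp only [Fin.cons_zero]; fun_prop
    · simp only [Fin.cons_succ]; fun_prop

theorem gaussianPDFReal_zero_le (v : ℝ≥0) (x : ℝ) :
    gaussianPDFReal 0 v x ≤ (√(2 * π * v))⁻¹ := by
  rw [gaussianPDFReal]
  refine mul_le_of_le_one_right (by positivity) (exp_le_one_iff.2 ?_)
  refine div_nonpos_of_nonpos_of_nonneg (by nlinarith [sq_nonneg (x - 0)]) (by positivity)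

theorem continuous_gaussianPDFReal (v : ℝ≥0) : Continuous (gaussianPDFReal 0 v) := by
  unfold gaussianPDFReal; fun_prop

theorem kssCov_sq_lt_one {d : ℕ} (hd : d ≠ 0) {τ : ℝ} (hτ : sin τ ≠ 0) : kssCov d τ ^ 2 < 1 := by
  rw [kssCov, ← pow_mul, mul_comm, pow_mul]
  refine pow_lt_one₀ (sq_nonneg _) ?_ hd
  have := sin_sq_add_cos_sq τ
  have : 0 < sin τ ^ 2 := by positivity
  linarith

theorem sin_sub_ne_zero {p : ℝ × ℝ} (hp : p ∈ anglePairs) : sin (p.1 - p.2) ≠ 0 := by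
  obtain ⟨⟨⟨h1, h2⟩, h3, h4⟩, hne⟩ := hp
  have hne' : p.1 ≠ p.2 := hne
  rcases lt_or_gt_of_ne hne' with h | h
  · exact (sin_neg_of_neg_of_neg_pi_lt (by linarith) (by linarith)).ne
  · exact (sin_pos_of_pos_of_lt_pi (by linarith) (by linarith)).ne'

/-- The integrand of the Kac-Rice formula. The values at the two angles, after whitening, are an
affine function of the two lowest coefficients that vanishes at `pairSolution`, and the
derivatives on this event are their residuals, so regression evaluates the integral. -/
theorem lintegral_pairSolution_fiber (k : ℕ) {p : ℝ × ℝ} (hp : p ∈ anglePairs) :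
    ∫⁻ r, ENNReal.ofReal |(pairSolutionDeriv r p).det| *
        ENNReal.ofReal (gaussianPDFReal 0 (kssVar (k + 1) 0) (pairSolution r p).1 *
          gaussianPDFReal 0 (kssVar (k + 1) 1) (pairSolution r p).2)
        ∂(Measure.pi fun i : Fin k => gaussianReal 0 (kssVar (k + 1) i.succ.succ)) =
      ENNReal.ofReal (pairDensity (k + 1) (p.1 - p.2)) := by
  set τ := p.1 - p.2 with hτ
  set d := k + 1 with hd
  set κ₀ := kssCov d τ with hκ₀
  set κ₁ := kssCovDeriv d τ with hκ₁
  set e := trigWeight d p.1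
  set f := trigWeight d p.2
  set e' := trigWeightDeriv d p.1
  set f' := trigWeightDeriv d p.2
  have hk : κ₀ ^ 2 < 1 := kssCov_sq_lt_one (by omega) (sin_sub_ne_zero hp)
  obtain ⟨hS, hρ, hlaw⟩ := (isStationaryGram_trigWeight d p.1 p.2).map_eq hk
    (S := kssCondVar d τ) (ρ := kssCondCorr d τ) rfl rfl
  have hc1 := cos_pos_of_mem_Ioo hp.1.1
  have hc2 := cos_pos_of_mem_Ioo hp.1.2
  have hΔ := tan_sub_tan_ne_zero hp
  have hpos : 0 < 1 - κ₀ ^ 2 := by linarith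
  have hsq : 0 < √(1 - κ₀ ^ 2) := sqrt_pos.2 hpos
  set s := √(1 - κ₀ ^ 2) with hs
  set C₁ := cos p.1 ^ d with hC₁
  set C₂ := cos p.2 ^ d with hC₂
  have hC₁0 : 0 < C₁ := by positivity
  have hC₂0 : 0 < C₂ := by positivity
  set S := kssCondVar d τ
  set ρ := kssCondCorr d τ
  set κ : Measure (ℝ × ℝ) := ((gaussianReal 0 1).prod (gaussianReal 0 1)).map
    fun z : ℝ × ℝ => (√S * z.1, √S * (ρ * z.1 + √(1 - ρ ^ 2) * z.2)) with hκ
  have : IsProbabilityMeasure κ := Measure.isProbabilityMeasure_map (by fun_prop)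
  set coef : (Fin k → ℝ) → ℝ × ℝ → (Fin (d + 1) → ℝ) :=
    fun r b => Fin.cons b.1 (Fin.cons b.2 r) with hcoef
  have hcoefc : Continuous fun z : (Fin k → ℝ) × (ℝ × ℝ) => coef z.1 z.2 :=
    continuous_fin_cons_cons
  set U : (Fin k → ℝ) → ℝ × ℝ → ℝ × ℝ := fun r b =>
    (linForm (IsStationaryGram.residualLeft e f e' κ₀ κ₁) (coef r b),
      linForm (IsStationaryGram.residualRight e f f' κ₀ κ₁) (coef r b)) with hU
  have hUc : Continuous fun z : (Fin k → ℝ) × (ℝ × ℝ) => U z.1 z.2 :=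
    ((ContinuousLinearMap.continuous _).comp hcoefc).prodMk
      ((ContinuousLinearMap.continuous _).comp hcoefc)
  set M := planeMap C₁ (C₁ * tan p.1) ((C₂ - κ₀ * C₁) / s)
    ((C₂ * tan p.2 - κ₀ * (C₁ * tan p.1)) / s) with hM
  have hMdet : M.det = C₁ * C₂ * (tan p.2 - tan p.1) / s := by
    rw [hM, det_planeMap]; field_simp; ring
  have hMdet0 : M.det ≠ 0 := by
    rw [hMdet]
    have : tan p.2 - tan p.1 ≠ 0 := fun h => hΔ (by linarith)
    positivity
  have he : ∀ c, linForm e c = C₁ * polyValue c (tan p.1) := linForm_trigWeight d hc1.ne'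
  have hf : ∀ c, linForm f c = C₂ * polyValue c (tan p.2) := linForm_trigWeight d hc2.ne'
  have hsol := fun r : Fin k → ℝ => polyValue_pairSolution r hp
  -- the whitened values are an affine function of `b` vanishing at the solution
  have hMval : ∀ (r : Fin k → ℝ) (b : ℝ × ℝ), M (b - pairSolution r p) =
      (linForm e (coef r b), linForm (IsStationaryGram.whitened e f κ₀) (coef r b)) := by
    intro r b
    have h := hsol r
    simp only [polyValue_cons_cons] at h
    rw [linForm_whitened, he, hf, hM, planeMap_apply]
    simp only [hcoef]
    simp only [polyValue_cons_cons, Prod.fst_sub, Prod.snd_sub]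
    refine Prod.ext ?_ ?_
    · linear_combination (-C₁) * h.1
    · simp only []
      rw [← hs]
      linear_combination (-C₂ / s) * h.2 + (κ₀ * C₁ / s) * h.1
  have hval : ∀ r : Fin k → ℝ, ENNReal.ofReal |(pairSolutionDeriv r p).det| =
      ENNReal.ofReal (C₁ * C₂ * |tan p.1 - tan p.2|)⁻¹ *
        ENNReal.ofReal |(U r (pairSolution r p)).1 * (U r (pairSolution r p)).2| := by
    intro r
    have h := hsol r
    have h1 := linForm_trigWeightDeriv_of_zero d hc1.ne' _ h.1
      (hasDerivAt_polyValue_tan _ _ r hc1.ne')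
    have h2 := linForm_trigWeightDeriv_of_zero d hc2.ne' _ h.2
      (hasDerivAt_polyValue_tan _ _ r hc2.ne')
    have hUval : U r (pairSolution r p) = (C₁ * polyTanDeriv (pairSlope r p) r p.1,
        C₂ * polyTanDeriv (pairSlope r p) r p.2) := by
      simp only [hU, linForm_residualLeft, linForm_residualRight, he, hf]
      simp only [hcoef]
      refine Prod.ext ?_ ?_
      · simp only []
        rw [h.1, h.2]
        simp only [mul_zero, sub_zero, add_zero]
        exact h1
      · simp only []
        rw [h.1, h.2]
        simp only [mul_zero, sub_zero, add_zero]
        exact h2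
    rw [← ENNReal.ofReal_mul (by positivity), hUval, det_pairSolutionDeriv]
    congr 1
    simp only [abs_div, abs_neg, abs_mul, abs_of_pos hC₁0, abs_of_pos hC₂0]
    have : |tan p.1 - tan p.2| ≠ 0 := abs_ne_zero.2 hΔ
    field_simp
  have hv0 : kssVar d 0 ≠ 0 := by simp [kssVar]
  have hv1 : kssVar d 1 ≠ 0 := by
    simp only [kssVar, ne_eq, Nat.cast_eq_zero]
    have : ((1 : Fin (d + 1)) : ℕ) = 1 := by rw [hd]; rfl
    rw [this, Nat.choose_one_right]; omega
  set φ : ℝ × ℝ → ℝ := fun b =>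
    gaussianPDFReal 0 (kssVar d 0) b.1 * gaussianPDFReal 0 (kssVar d 1) b.2 with hφ
  set ψ : ℝ × ℝ → ℝ := fun b => gaussianPDFReal 0 1 b.1 * gaussianPDFReal 0 1 b.2 with hψ
  have hlaw' : ∀ (h : ℝ × ℝ → ℝ≥0∞) (G : ℝ × ℝ → ℝ≥0∞), Measurable h → Measurable G →
      ∫⁻ r, ∫⁻ b, ENNReal.ofReal (φ b) * (h (M (b - pairSolution r p)) * G (U r b)) ∂volume
        ∂(Measure.pi fun i : Fin k => gaussianReal 0 (kssVar d i.succ.succ)) =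
      (∫⁻ u, h u * ENNReal.ofReal (ψ u)) * ∫⁻ w, G w ∂κ := by
    intro h G hh hG
    set Λ : (Fin (d + 1) → ℝ) → (ℝ × ℝ) × (ℝ × ℝ) := fun c =>
      ((linForm e c, linForm (IsStationaryGram.whitened e f κ₀) c),
        (linForm (IsStationaryGram.residualLeft e f e' κ₀ κ₁) c,
          linForm (IsStationaryGram.residualRight e f f' κ₀ κ₁) c)) with hΛ
    have hΛm : Measurable Λ := by fun_prop
    have hm : Measurable fun z : (ℝ × ℝ) × (ℝ × ℝ) => h z.1 * G z.2 := by fun_prop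
    have h1 := lintegral_pi_gaussianReal_split_two (n := k) (kssVar d) hv0 hv1 (hm.comp hΛm)
    have h2 : ∫⁻ c, ((fun z : (ℝ × ℝ) × (ℝ × ℝ) => h z.1 * G z.2) ∘ Λ) c
        ∂(Measure.pi fun i => gaussianReal 0 (kssVar d i)) =
        (∫⁻ u, h u * ENNReal.ofReal (ψ u)) * ∫⁻ w, G w ∂κ := by
      rw [← lintegral_gaussianReal_prod hh one_ne_zero one_ne_zero,
        ← lintegral_prod_mul hh.aemeasurable hG.aemeasurable, ← hlaw, lintegral_map hm hΛm]
      rfl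
    rw [← h2, h1]
    refine lintegral_congr fun r => lintegral_congr fun b => ?_
    rw [hMval, mul_comm]
    rfl
  have hmain := lintegral_density_mul_of_law (volume : Measure (ℝ × ℝ))
    (Measure.pi fun i : Fin k => gaussianReal 0 (kssVar d i.succ.succ)) (φ := φ) (ψ := ψ)
    (C := (√(2 * π * kssVar d 0))⁻¹ * (√(2 * π * kssVar d 1))⁻¹)
    (((continuous_gaussianPDFReal _).comp continuous_fst).mul
      ((continuous_gaussianPDFReal _).comp continuous_snd))
    (fun b => mul_nonneg (gaussianPDFReal_nonneg _ _ _) (gaussianPDFReal_nonneg _ _ _))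
    (fun b => mul_le_mul (gaussianPDFReal_zero_le _ _) (gaussianPDFReal_zero_le _ _)
      (gaussianPDFReal_nonneg _ _ _) (by positivity))
    (((continuous_gaussianPDFReal _).comp continuous_fst).mul
      ((continuous_gaussianPDFReal _).comp continuous_snd))
    M hMdet0 (F := fun r => pairSolution r p)
    (measurable_pairSolution.comp (measurable_id.prodMk measurable_const))
    (U := U) (fun r => hUc.comp (Continuous.prodMk_right r)) hUc.measurable κ hlaw'
    (G := fun w => ENNReal.ofReal |w.1 * w.2|) (by fun_prop)
  have hκint : ∫⁻ w, ENNReal.ofReal |w.1 * w.2| ∂κ = ENNReal.ofReal (S * (2 / π * absMoment ρ)) := by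
    rw [hκ, lintegral_map (by fun_prop) (by fun_prop), ENNReal.ofReal_mul hS, absMoment,
      ← lintegral_abs_mul_gaussian hρ, ← lintegral_const_mul _ (by fun_prop)]
    refine lintegral_congr fun z => ?_
    rw [← ENNReal.ofReal_mul hS]
    congr 1
    have : √S * z.1 * (√S * (ρ * z.1 + √(1 - ρ ^ 2) * z.2)) =
      (√S * √S) * (z.1 * (ρ * z.1 + √(1 - ρ ^ 2) * z.2)) := by ring
    rw [this, mul_self_sqrt hS, abs_mul, abs_of_nonneg hS]
  have hψ0 : ψ 0 = (2 * π)⁻¹ := by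
    simp only [hψ, Prod.fst_zero, Prod.snd_zero, gaussianPDFReal_zero_one]
    rw [zero_pow two_ne_zero, neg_zero, zero_div, exp_zero, mul_one, ← mul_inv,
      mul_self_sqrt (by positivity)]
  have hrw : ∀ r : Fin k → ℝ, ENNReal.ofReal |(pairSolutionDeriv r p).det| *
        ENNReal.ofReal (gaussianPDFReal 0 (kssVar d 0) (pairSolution r p).1 *
          gaussianPDFReal 0 (kssVar d 1) (pairSolution r p).2) =
      ENNReal.ofReal (C₁ * C₂ * |tan p.1 - tan p.2|)⁻¹ * (ENNReal.ofReal (φ (pairSolution r p)) *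
        ENNReal.ofReal |(U r (pairSolution r p)).1 * (U r (pairSolution r p)).2|) := by
    intro r
    rw [hval r, mul_assoc]
    congr 1
    exact mul_comm _ _
  rw [lintegral_congr hrw, lintegral_const_mul' _ _ ENNReal.ofReal_ne_top]
  rw [hmain, hκint, hψ0, ← ENNReal.ofReal_mul (by positivity), ← ENNReal.ofReal_mul (by positivity),
    ← ENNReal.ofReal_mul (by positivity)]
  congr 1
  rw [hMdet, pairDensity, abs_div, abs_mul, abs_mul, abs_of_pos hC₁0, abs_of_pos hC₂0,
    abs_of_pos hsq, abs_sub_comm (tan p.2)]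
  have : |tan p.1 - tan p.2| ≠ 0 := abs_ne_zero.2 hΔ
  rw [← hd, ← hκ₀, ← hs]
  field_simp
  rfl

/-- The Kac-Rice formula for the second factorial moment: for fixed higher coefficients, the
ordered pairs of roots are the fibre of `pairSolution` over the two lowest coefficients. -/
theorem lintegral_factorial_numRealRoots (k : ℕ) :
    ∫⁻ c, ((numRealRoots c * numRealRoots c - numRealRoots c : ℕ) : ℝ≥0∞) ∂(kssMeasure (k + 1)) =
      ∫⁻ p in anglePairs, ENNReal.ofReal (pairDensity (k + 1) (p.1 - p.2)) := by
  have hv0 : kssVar (k + 1) 0 ≠ 0 := by simp [kssVar]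
  have hv1 : kssVar (k + 1) 1 ≠ 0 := by
    simp only [kssVar, ne_eq, Nat.cast_eq_zero]
    have : ((1 : Fin (k + 1 + 1)) : ℕ) = 1 := rfl
    rw [this, Nat.choose_one_right]; omega
  have hN := measurable_numRealRoots (k + 1)
  have hm : Measurable fun c : Fin (k + 1 + 1) → ℝ =>
      ((numRealRoots c * numRealRoots c - numRealRoots c : ℕ) : ℝ≥0∞) :=
    (measurable_from_top (f := fun n : ℕ => ((n * n - n : ℕ) : ℝ≥0∞))).comp hN
  rw [kssMeasure, lintegral_pi_gaussianReal_split_two (n := k) (kssVar (k + 1)) hv0 hv1 hm]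
  rw [← setLIntegral_congr_fun measurableSet_anglePairs
    fun p hp => lintegral_pairSolution_fiber k hp]
  set φ : ℝ × ℝ → ℝ≥0∞ := fun b => ENNReal.ofReal (gaussianPDFReal 0 (kssVar (k + 1) 0) b.1 *
    gaussianPDFReal 0 (kssVar (k + 1) 1) b.2) with hφ
  have hφm : Measurable φ := ENNReal.measurable_ofReal.comp
    (((continuous_gaussianPDFReal _).comp continuous_fst).mul
      ((continuous_gaussianPDFReal _).comp continuous_snd)).measurable
  refine Eq.trans ?_ (lintegral_lintegral_encard_fiber_mul
    (Measure.pi fun i : Fin k => gaussianReal 0 (kssVar (k + 1) i.succ.succ))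
    (volume : Measure (ℝ × ℝ)) measurableSet_anglePairs
    (F := fun r => pairSolution r) (F' := fun r => pairSolutionDeriv r)
    (fun r p hp => (hasFDerivAt_pairSolution r hp).hasFDerivWithinAt)
    measurable_det_pairSolutionDeriv measurable_pairSolution hφm)
  refine lintegral_congr fun r => lintegral_congr_ae ?_
  -- the zero polynomial has to be excluded: its root set is infinite, but `numRealRoots` is `0`
  filter_upwards [compl_mem_ae_iff.2 (measure_singleton (0 : ℝ × ℝ))] with b hb
  have hc : (Fin.cons b.1 (Fin.cons b.2 r) : Fin (k + 1 + 1) → ℝ) ≠ 0 := fun h => hb <| by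
    have h0 := congrFun h 0
    have h1 := congrFun h 1
    rw [Fin.cons_zero] at h0
    have h1' : (Fin.cons b.1 (Fin.cons b.2 r) : Fin (k + 1 + 1) → ℝ) 1 = b.2 := rfl
    rw [h1'] at h1
    exact Prod.ext h0 h1
  rw [encard_inter_pairSolution_fiber,
    encard_offDiag_of_finite (realZeros_finite_and_ncard_le hc).1]
  rfl

end FactorialMoment

/-! ### The mean number of real roots -/

section FirstMoment

open scoped ENNReal NNReal
open Real

/-- The derivative of `polyValue c`. -/
def polyDeriv {d : ℕ} (c : Fin (d + 1) → ℝ) (x : ℝ) : ℝ :=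
  ∑ n : Fin (d + 1), c n * ((n : ℕ) * x ^ ((n : ℕ) - 1))

theorem hasDerivAt_polyValue {d : ℕ} (c : Fin (d + 1) → ℝ) (x : ℝ) :
    HasDerivAt (polyValue c) (polyDeriv c x) x :=
  HasDerivAt.fun_sum fun n _ => (hasDerivAt_pow (n : ℕ) x).const_mul (c n)

theorem polyValue_cons {d : ℕ} (b : ℝ) (r : Fin d → ℝ) (x : ℝ) :
    polyValue (Fin.cons b r) x = b + polyValue (Fin.cons 0 r) x := by
  simp [polyValue, Fin.sum_univ_succ]

theorem polyDeriv_cons {d : ℕ} (b : ℝ) (r : Fin d → ℝ) (x : ℝ) :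
    polyDeriv (Fin.cons b r) x = polyDeriv (Fin.cons 0 r) x := by
  simp [polyDeriv, Fin.sum_univ_succ]

/-- The constant coefficient for which the polynomial with higher coefficients `r` vanishes at
`tan θ`. -/
noncomputable def rootSolution {d : ℕ} (r : Fin d → ℝ) (θ : ℝ) : ℝ :=
  -polyValue (Fin.cons 0 r) (tan θ)

/-- The derivative of `rootSolution r`. -/
noncomputable def rootSolutionDeriv {d : ℕ} (r : Fin d → ℝ) (θ : ℝ) : ℝ :=
  -(polyDeriv (Fin.cons 0 r) (tan θ) * (1 / cos θ ^ 2))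

theorem hasDerivAt_rootSolution {d : ℕ} (r : Fin d → ℝ) {θ : ℝ} (hθ : cos θ ≠ 0) :
    HasDerivAt (rootSolution r) (rootSolutionDeriv r θ) θ :=
  ((hasDerivAt_polyValue (Fin.cons 0 r) (tan θ)).comp θ (hasDerivAt_tan hθ)).neg

theorem polyValue_rootSolution {d : ℕ} (r : Fin d → ℝ) (θ : ℝ) :
    polyValue (Fin.cons (rootSolution r θ) r) (tan θ) = 0 := by
  rw [polyValue_cons, rootSolution]; ring

theorem encard_inter_rootSolution_fiber {d : ℕ} (r : Fin d → ℝ) (b : ℝ) :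
    (Set.Ioo (-(π / 2)) (π / 2) ∩ rootSolution r ⁻¹' {b}).encard =
      (realZeros (Fin.cons b r)).encard := by
  have hinj : Set.InjOn tan (Set.Ioo (-(π / 2)) (π / 2) ∩ rootSolution r ⁻¹' {b}) :=
    injOn_tan.mono Set.inter_subset_left
  rw [← hinj.encard_image]
  congr 1
  ext x
  simp only [Set.mem_image, Set.mem_inter_iff, Set.mem_preimage, Set.mem_singleton_iff]
  constructor
  · rintro ⟨θ, ⟨hθ, rfl⟩, rfl⟩
    exact polyValue_rootSolution r θ
  · intro hx
    have hx' : b + polyValue (Fin.cons 0 r) x = 0 := by rw [← polyValue_cons]; exact hx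
    refine ⟨arctan x, ⟨arctan_mem_Ioo x, ?_⟩, tan_arctan x⟩
    rw [rootSolution, tan_arctan]; linarith

theorem measurable_rootSolution {d : ℕ} :
    Measurable fun z : (Fin d → ℝ) × ℝ => rootSolution z.1 z.2 := by
  refine Measurable.neg ?_
  refine (polyValue_continuous.measurable).comp (Measurable.prodMk ?_ ?_)
  · exact measurable_fin_cons.comp (measurable_const.prodMk measurable_fst)
  · exact measurable_tan.comp measurable_snd

theorem measurable_rootSolutionDeriv {d : ℕ} :
    Measurable fun z : (Fin d → ℝ) × ℝ => rootSolutionDeriv z.1 z.2 := by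
  refine Measurable.neg (Measurable.mul ?_ ?_)
  · have h : Continuous fun p : (Fin (d + 1) → ℝ) × ℝ => polyDeriv p.1 p.2 := by
      unfold polyDeriv; fun_prop
    refine h.measurable.comp (Measurable.prodMk ?_ ?_)
    · exact measurable_fin_cons.comp (measurable_const.prodMk measurable_fst)
    · exact measurable_tan.comp measurable_snd
  · fun_prop

theorem continuous_fin_cons {d : ℕ} :
    Continuous fun p : (Fin d → ℝ) × ℝ => (Fin.cons p.2 p.1 : Fin (d + 1) → ℝ) := by
  refine continuous_pi fun i => ?_
  refine Fin.cases ?_ (fun j => ?_) i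
  · simp only [Fin.cons_zero]; fun_prop
  · simp only [Fin.cons_succ]; fun_prop

/-- The zeros of the stationary process have constant density `√d / π`. -/
theorem lintegral_rootSolution_fiber (d : ℕ) {θ : ℝ} (hθ : θ ∈ Set.Ioo (-(π / 2)) (π / 2)) :
    ∫⁻ r, ENNReal.ofReal |rootSolutionDeriv r θ| *
        ENNReal.ofReal (gaussianPDFReal 0 (kssVar d 0) (rootSolution r θ))
        ∂(Measure.pi fun i : Fin d => gaussianReal 0 (kssVar d i.succ)) =
      ENNReal.ofReal (√d / π) := by
  have hc := cos_pos_of_mem_Ioo hθ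
  set C := cos θ ^ d with hC
  have hC0 : 0 < C := by positivity
  set e := trigWeight d θ
  set e' := trigWeightDeriv d θ
  have hgram := isStationaryGram_trigWeight d θ θ
  have hlaw := map_pi_gaussianReal_pair (kssVar d) (S := (d : ℝ≥0)) hgram.ee hgram.ee'
    (by simpa using hgram.e'e')
  have he : ∀ c, linForm e c = C * polyValue c (tan θ) := linForm_trigWeight d hc.ne'
  set U : (Fin d → ℝ) → ℝ → ℝ := fun r b => linForm e' (Fin.cons b r) with hU
  have hUc : Continuous fun z : (Fin d → ℝ) × ℝ => U z.1 z.2 :=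
    (ContinuousLinearMap.continuous _).comp continuous_fin_cons
  set M : ℝ →L[ℝ] ℝ := C • ContinuousLinearMap.id ℝ ℝ with hM
  have hMdet : M.det = C := by
    rw [hM, ContinuousLinearMap.det]; simp
  have hMval : ∀ (r : Fin d → ℝ) (b : ℝ), M (b - rootSolution r θ) =
      linForm e (Fin.cons b r) := by
    intro r b
    rw [he, polyValue_cons, rootSolution, hM]
    change C * (b - -polyValue (Fin.cons 0 r) (tan θ)) = _
    ring
  have hval : ∀ r : Fin d → ℝ, ENNReal.ofReal |rootSolutionDeriv r θ| =
      ENNReal.ofReal C⁻¹ * ENNReal.ofReal |U r (rootSolution r θ)| := by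
    intro r
    have h1 := linForm_trigWeightDeriv_of_zero d hc.ne' _ (polyValue_rootSolution r θ)
      ((hasDerivAt_polyValue _ (tan θ)).comp θ (hasDerivAt_tan hc.ne'))
    rw [polyDeriv_cons] at h1
    simp only [hU]
    rw [h1, ← ENNReal.ofReal_mul (by positivity), abs_mul, abs_of_pos hC0, rootSolutionDeriv,
      abs_neg]
    congr 1
    field_simp
  have hv0 : kssVar d 0 = 1 := by simp [kssVar]
  set φ : ℝ → ℝ := gaussianPDFReal 0 (kssVar d 0) with hφ
  have hlaw' : ∀ (h G : ℝ → ℝ≥0∞), Measurable h → Measurable G →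
      ∫⁻ r, ∫⁻ b, ENNReal.ofReal (φ b) * (h (M (b - rootSolution r θ)) * G (U r b)) ∂volume
        ∂(Measure.pi fun i : Fin d => gaussianReal 0 (kssVar d i.succ)) =
      (∫⁻ u, h u * ENNReal.ofReal (gaussianPDFReal 0 1 u)) *
        ∫⁻ w, G w ∂(gaussianReal 0 (d : ℝ≥0)) := by
    intro h G hh hG
    set Λ : (Fin (d + 1) → ℝ) → ℝ × ℝ := fun c => (linForm e c, linForm e' c) with hΛ
    have hΛm : Measurable Λ := by fun_prop
    have hm : Measurable fun z : ℝ × ℝ => h z.1 * G z.2 := by fun_prop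
    have h1 := lintegral_pi_gaussianReal_split (kssVar d) (by rw [hv0]; exact one_ne_zero)
      (hm.comp hΛm)
    have h2 : ∫⁻ c, ((fun z : ℝ × ℝ => h z.1 * G z.2) ∘ Λ) c
        ∂(Measure.pi fun i => gaussianReal 0 (kssVar d i)) =
        (∫⁻ u, h u * ENNReal.ofReal (gaussianPDFReal 0 1 u)) *
          ∫⁻ w, G w ∂(gaussianReal 0 (d : ℝ≥0)) := by
      have h3 : ∫⁻ u, h u * ENNReal.ofReal (gaussianPDFReal 0 1 u) =
          ∫⁻ u, h u ∂(gaussianReal 0 1) := by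
        rw [gaussianReal_of_var_ne_zero _ one_ne_zero,
          lintegral_withDensity_eq_lintegral_mul _ (measurable_gaussianPDF _ _) hh]
        exact lintegral_congr fun b => mul_comm _ _
      rw [h3, ← lintegral_prod_mul hh.aemeasurable hG.aemeasurable, ← hlaw, lintegral_map hm hΛm]
      rfl
    rw [← h2, h1]
    refine lintegral_congr fun r => lintegral_congr fun b => ?_
    rw [hMval, mul_comm]
    rfl
  have hmain := lintegral_density_mul_of_law (volume : Measure ℝ)
    (Measure.pi fun i : Fin d => gaussianReal 0 (kssVar d i.succ)) (φ := φ)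
    (ψ := gaussianPDFReal 0 1) (continuous_gaussianPDFReal _)
    (fun b => gaussianPDFReal_nonneg _ _ _) (fun b => gaussianPDFReal_zero_le _ _)
    (continuous_gaussianPDFReal _) M (by rw [hMdet]; exact hC0.ne')
    (F := fun r => rootSolution r θ)
    (measurable_rootSolution.comp (measurable_id.prodMk measurable_const))
    (U := U) (fun r => hUc.comp (Continuous.prodMk_right r)) hUc.measurable _ hlaw'
    (G := fun w => ENNReal.ofReal |w|) (by fun_prop)
  have hrw : ∀ r : Fin d → ℝ, ENNReal.ofReal |rootSolutionDeriv r θ| *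
        ENNReal.ofReal (gaussianPDFReal 0 (kssVar d 0) (rootSolution r θ)) =
      ENNReal.ofReal C⁻¹ * (ENNReal.ofReal (φ (rootSolution r θ)) *
        ENNReal.ofReal |U r (rootSolution r θ)|) := by
    intro r
    rw [hval r, mul_assoc]
    congr 1
    exact mul_comm _ _
  have hψ0 : gaussianPDFReal 0 1 0 = (√(2 * π))⁻¹ := by
    rw [gaussianPDFReal_zero_one]; simp
  rw [lintegral_congr hrw, lintegral_const_mul' _ _ ENNReal.ofReal_ne_top, hmain,
    lintegral_abs_gaussianReal, hψ0, hMdet, ← ENNReal.ofReal_mul (by positivity),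
    ← ENNReal.ofReal_mul (by positivity), ← ENNReal.ofReal_mul (by positivity)]
  congr 1
  have h2 : √2 * √2 = (2 : ℝ) := mul_self_sqrt zero_le_two
  have h3 : √π * √π = π := mul_self_sqrt pi_pos.le
  rw [abs_of_pos hC0, sqrt_mul zero_le_two, sqrt_div zero_le_two, NNReal.coe_natCast]
  field_simp
  linear_combination (-√(d : ℝ)) * h3

/-- The Kac-Rice formula for the mean number of real roots, known to Edelman and Kostlan. -/
theorem lintegral_numRealRoots (d : ℕ) :
    ∫⁻ c, (numRealRoots c : ℝ≥0∞) ∂(kssMeasure d) = ENNReal.ofReal √d := by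
  have hv0 : kssVar d 0 ≠ 0 := by simp [kssVar]
  have hm : Measurable fun c : Fin (d + 1) → ℝ => (numRealRoots c : ℝ≥0∞) :=
    (measurable_from_top (f := fun n : ℕ => (n : ℝ≥0∞))).comp (measurable_numRealRoots d)
  have hdet : ∀ a : ℝ, (ContinuousLinearMap.toSpanSingleton ℝ a).det = a :=
    ContinuousLinearMap.det_toSpanSingleton
  have h := lintegral_lintegral_encard_fiber_mul
    (Measure.pi fun i : Fin d => gaussianReal 0 (kssVar d i.succ))
    (volume : Measure ℝ) (s := Set.Ioo (-(π / 2)) (π / 2)) measurableSet_Ioo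
    (F := fun r => rootSolution r)
    (F' := fun r θ => ContinuousLinearMap.toSpanSingleton ℝ (rootSolutionDeriv r θ))
    (fun r θ hθ => (hasDerivAt_rootSolution r
      (cos_pos_of_mem_Ioo hθ).ne').hasFDerivAt.hasFDerivWithinAt)
    (by simp_rw [hdet]; exact measurable_rootSolutionDeriv) measurable_rootSolution
    (g := fun b => ENNReal.ofReal (gaussianPDFReal 0 (kssVar d 0) b))
    (ENNReal.measurable_ofReal.comp (continuous_gaussianPDFReal _).measurable)
  simp only [hdet] at h
  rw [setLIntegral_congr_fun measurableSet_Ioo fun θ hθ => lintegral_rootSolution_fiber d hθ,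
    setLIntegral_const, volume_Ioo, ← ENNReal.ofReal_mul (by positivity)] at h
  rw [kssMeasure, lintegral_pi_gaussianReal_split (kssVar d) hv0 hm]
  refine Eq.trans (Eq.trans ?_ h) ?_
  · refine lintegral_congr fun r => lintegral_congr_ae ?_
    filter_upwards [compl_mem_ae_iff.2 (measure_singleton (0 : ℝ))] with b hb
    have hc : (Fin.cons b r : Fin (d + 1) → ℝ) ≠ 0 := fun h => hb <| by
      have h0 := congrFun h 0
      rwa [Fin.cons_zero] at h0
    rw [encard_inter_rootSolution_fiber,
      ← (realZeros_finite_and_ncard_le hc).1.cast_ncard_eq]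
    rfl
  · congr 1
    field_simp
    ring

end FirstMoment

/-! ### Symmetries of the density of pairs of zeros -/

section PairDensity

open scoped ENNReal NNReal
open Real

theorem measurable_pairDensity (d : ℕ) : Measurable (pairDensity d) := by
  unfold pairDensity absMoment kssCondCorr kssCondVar kssCov kssCovDeriv kssCovDeriv₂
  fun_prop

/-- These bounds hold because the quantities are a variance and a correlation. -/
theorem kssCondVar_nonneg_and_kssCondCorr_sq_le_one {d : ℕ} (hd : d ≠ 0) {τ : ℝ}
    (hτ : sin τ ≠ 0) : 0 ≤ kssCondVar d τ ∧ kssCondCorr d τ ^ 2 ≤ 1 := by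
  have h := (isStationaryGram_trigWeight d τ 0).map_eq (S := kssCondVar d τ)
    (ρ := kssCondCorr d τ) (by rw [sub_zero]; exact kssCov_sq_lt_one hd hτ)
    (by rw [sub_zero]; rfl) (by rw [sub_zero]; rfl)
  exact ⟨h.1, h.2.1⟩

theorem pairDensity_nonneg {d : ℕ} (hd : d ≠ 0) (τ : ℝ) : 0 ≤ pairDensity d τ := by
  refine mul_nonneg (mul_nonneg (by positivity) (div_nonneg ?_ (sqrt_nonneg _)))
    (absMoment_nonneg _)
  by_cases h : sin τ = 0
  · simp [kssCondVar, kssCovDeriv, h]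
  · exact (kssCondVar_nonneg_and_kssCondCorr_sq_le_one hd h).1

theorem absMoment_neg (ρ : ℝ) : absMoment (-ρ) = absMoment ρ := by
  simp [absMoment, arcsin_neg]

/-- Replacing `τ` by `τ + π` multiplies the covariance and its derivatives by `(-1) ^ d`. -/
theorem pairDensity_periodic {d : ℕ} (hd : 2 ≤ d) : Function.Periodic (pairDensity d) π := by
  obtain ⟨m, rfl⟩ := Nat.exists_eq_add_of_le hd
  intro τ
  have h0 : kssCov (2 + m) (τ + π) = (-1) ^ m * kssCov (2 + m) τ := by
    simp only [kssCov, cos_add_pi]; rw [neg_pow, pow_add]; ring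
  have h1 : kssCovDeriv (2 + m) (τ + π) = (-1) ^ m * kssCovDeriv (2 + m) τ := by
    simp only [kssCovDeriv, cos_add_pi, sin_add_pi, show 2 + m - 1 = m + 1 by omega]
    rw [neg_pow, pow_succ]; ring
  have h2 : kssCovDeriv₂ (2 + m) (τ + π) = (-1) ^ m * kssCovDeriv₂ (2 + m) τ := by
    simp only [kssCovDeriv₂, cos_add_pi, sin_add_pi, show 2 + m - 1 = m + 1 by omega,
      show 2 + m - 2 = m by omega]
    rw [neg_pow (cos τ), neg_pow (cos τ), pow_succ]; ring
  have hsq : ((-1 : ℝ) ^ m) ^ 2 = 1 := by rw [← pow_mul, mul_comm, pow_mul]; simp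
  have h3 : kssCov (2 + m) (τ + π) ^ 2 = kssCov (2 + m) τ ^ 2 := by
    rw [h0, mul_pow, hsq, one_mul]
  have h4 : kssCovDeriv (2 + m) (τ + π) ^ 2 = kssCovDeriv (2 + m) τ ^ 2 := by
    rw [h1, mul_pow, hsq, one_mul]
  have h5 : kssCondVar (2 + m) (τ + π) = kssCondVar (2 + m) τ := by
    rw [kssCondVar, h3, h4, kssCondVar]
  have h6 : kssCondCorr (2 + m) (τ + π) = (-1) ^ m * kssCondCorr (2 + m) τ := by
    rw [kssCondCorr, h2, h3, h4, h5, h0, kssCondCorr]; ring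
  have h7 : absMoment (kssCondCorr (2 + m) (τ + π)) = absMoment (kssCondCorr (2 + m) τ) := by
    rw [h6]
    rcases neg_one_pow_eq_or ℝ m with h | h <;> simp [h, absMoment_neg]
  rw [pairDensity, h3, h5, h7, pairDensity]

theorem pairDensity_neg (d : ℕ) (τ : ℝ) : pairDensity d (-τ) = pairDensity d τ := by
  have h0 : kssCov d (-τ) = kssCov d τ := by simp [kssCov]
  have h1 : kssCovDeriv d (-τ) = -kssCovDeriv d τ := by simp [kssCovDeriv]
  have h2 : kssCovDeriv₂ d (-τ) = kssCovDeriv₂ d τ := by simp [kssCovDeriv₂]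
  have h3 : kssCondVar d (-τ) = kssCondVar d τ := by simp [kssCondVar, h0, h1]
  have h4 : kssCondCorr d (-τ) = kssCondCorr d τ := by simp [kssCondCorr, h0, h1, h2, h3]
  rw [pairDensity, pairDensity, h0, h3, h4]

/-- For a function of period `π`, averaging over pairs of angles amounts to averaging over their
difference. -/
theorem setLIntegral_anglePairs_sub {f : ℝ → ℝ≥0∞} (hf : Measurable f)
    (hper : Function.Periodic f π) :
    ∫⁻ p in anglePairs, f (p.1 - p.2) =
      ENNReal.ofReal π * ∫⁻ τ in Set.Ioc (-(π / 2)) (π / 2), f τ := by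
  have hdiag : (volume : Measure (ℝ × ℝ)) {p | p.1 = p.2} = 0 := by
    have hm : MeasurableSet {p : ℝ × ℝ | p.1 = p.2} :=
      measurableSet_eq_fun measurable_fst measurable_snd
    rw [Measure.volume_eq_prod, Measure.measure_prod_null hm]
    refine ae_of_all _ fun x => ?_
    have : Prod.mk x ⁻¹' {p : ℝ × ℝ | p.1 = p.2} = {x} := by ext y; simp [eq_comm]
    change volume (Prod.mk x ⁻¹' {p : ℝ × ℝ | p.1 = p.2}) = 0
    rw [this, volume_singleton]
  have h1 : anglePairs =ᵐ[volume] (Set.Ioc (-(π / 2)) (π / 2) ×ˢ Set.Ioc (-(π / 2)) (π / 2) :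
      Set (ℝ × ℝ)) := by
    have hIoo : (Set.Ioo (-(π / 2)) (π / 2) ×ˢ Set.Ioo (-(π / 2)) (π / 2) : Set (ℝ × ℝ)) =ᵐ[volume]
        (Set.Ioc (-(π / 2)) (π / 2) ×ˢ Set.Ioc (-(π / 2)) (π / 2) : Set (ℝ × ℝ)) :=
      Measure.set_prod_ae_eq Ioo_ae_eq_Ioc Ioo_ae_eq_Ioc
    refine EventuallyEq.trans ?_ hIoo
    have hu : ({p : ℝ × ℝ | p.1 ≠ p.2} : Set (ℝ × ℝ)) =ᵐ[volume] Set.univ := by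
      rw [ae_eq_univ]
      convert hdiag using 2
      ext p; simp
    have := (EventuallyEq.refl (ae (volume : Measure (ℝ × ℝ)))
      (Set.Ioo (-(π / 2)) (π / 2) ×ˢ Set.Ioo (-(π / 2)) (π / 2) : Set (ℝ × ℝ))).inter hu
    rwa [Set.inter_univ] at this
  rw [setLIntegral_congr h1, Measure.volume_eq_prod, ← Measure.prod_restrict,
    lintegral_prod_symm _ (by fun_prop)]
  have hπ : 0 < π := pi_pos
  have h2 : ∀ y : ℝ, ∫⁻ x in Set.Ioc (-(π / 2)) (π / 2), f (x - y) =
      ∫⁻ τ in Set.Ioc (-(π / 2)) (π / 2), f τ := by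
    intro y
    have e1 := (measurePreserving_sub_right (volume : Measure ℝ) y).setLIntegral_comp_preimage
      (s := Set.Ioc (-(π / 2) - y) (π / 2 - y)) measurableSet_Ioc hf
    have e2 : (fun x => x - y) ⁻¹' Set.Ioc (-(π / 2) - y) (π / 2 - y) =
        Set.Ioc (-(π / 2)) (π / 2) := by
      ext x; simp
    rw [e2] at e1
    rw [e1]
    have f1 := isAddFundamentalDomain_Ioc hπ (-(π / 2) - y) (volume : Measure ℝ)
    have f2 := isAddFundamentalDomain_Ioc hπ (-(π / 2)) (volume : Measure ℝ)
    rw [show -(π / 2) - y + π = π / 2 - y by ring] at f1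
    rw [show -(π / 2) + π = π / 2 by ring] at f2
    exact f1.setLIntegral_eq f2 f hper.map_vadd_zmultiples
  simp_rw [h2]
  rw [setLIntegral_const, volume_Ioc, mul_comm]
  congr 2; ring

end PairDensity

/-! ### The variance as an integral over the angle -/

section Variance

open scoped ENNReal NNReal
open Real

/-- The zero polynomial is no exception, since its root set is infinite and `ncard` is then `0`. -/
theorem numRealRoots_le {d : ℕ} (c : Fin (d + 1) → ℝ) : numRealRoots c ≤ d := by
  by_cases hc : c = 0
  · have : realZeros c = Set.univ := by ext x; simp [realZeros, polyValue, hc]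
    have hN : numRealRoots c = (realZeros c).ncard := rfl
    rw [hN, this, Set.infinite_univ.ncard]
    exact Nat.zero_le _
  · exact (realZeros_finite_and_ncard_le hc).2

theorem memLp_numRealRoots {d : ℕ} (μ : Measure (Fin (d + 1) → ℝ)) [IsFiniteMeasure μ] :
    MemLp (fun c => (numRealRoots c : ℝ)) 2 μ := by
  refine MemLp.of_bound (C := d) ?_ (ae_of_all _ fun c => ?_)
  · exact (measurable_from_top (f := fun n : ℕ => (n : ℝ))).comp (measurable_numRealRoots d)
      |>.aestronglyMeasurable
  · rw [norm_of_nonneg (Nat.cast_nonneg _)]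
    exact_mod_cast numRealRoots_le c

theorem IsKSS.hasLaw {Ω : Type*} [MeasurableSpace Ω] {P : Measure Ω} [IsProbabilityMeasure P]
    {d : ℕ} {a : Fin (d + 1) → Ω → ℝ} (ha : IsKSS P d a) :
    HasLaw (fun ω n => a n ω) (kssMeasure d) P where
  aemeasurable := aemeasurable_pi_lambda _ fun n => (ha.law n).aemeasurable
  map_eq := by
    rw [(iIndepFun_iff_map_fun_eq_pi_map fun n => (ha.law n).aemeasurable).1 ha.indep, kssMeasure]
    congr 1; ext1 n
    exact (ha.law n).map_eq

theorem IsKSS.memLp_rootCount {Ω : Type*} [MeasurableSpace Ω] {P : Measure Ω}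
    [IsProbabilityMeasure P] {d : ℕ} {a : Fin (d + 1) → Ω → ℝ} (ha : IsKSS P d a) :
    MemLp (rootCount a) 2 P := by
  have h := memLp_numRealRoots (kssMeasure d)
  rw [← ha.hasLaw.map_eq] at h
  exact h.comp_of_map ha.hasLaw.aemeasurable

theorem IsKSS.variance_rootCount {Ω : Type*} [MeasurableSpace Ω] {P : Measure Ω}
    [IsProbabilityMeasure P] {d : ℕ} {a : Fin (d + 1) → Ω → ℝ} (ha : IsKSS P d a) :
    Var[rootCount a; P] = Var[fun c => (numRealRoots c : ℝ); kssMeasure d] := by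
  have h := (memLp_numRealRoots (kssMeasure d)).aestronglyMeasurable.aemeasurable
  rw [← ha.hasLaw.map_eq] at h ⊢
  rw [variance_map h ha.hasLaw.aemeasurable]
  rfl

theorem integral_numRealRoots (d : ℕ) :
    ∫ c, (numRealRoots c : ℝ) ∂(kssMeasure d) = √d := by
  rw [integral_eq_lintegral_of_nonneg_ae (ae_of_all _ fun c => Nat.cast_nonneg _)
    (memLp_numRealRoots _).aestronglyMeasurable]
  simp_rw [ENNReal.ofReal_natCast]
  rw [lintegral_numRealRoots, ENNReal.toReal_ofReal (sqrt_nonneg _)]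

/-- The second factorial moment as an integral over the angular distance. -/
theorem integral_factorial_numRealRoots {d : ℕ} (hd : 2 ≤ d) :
    ∫ c, ((numRealRoots c : ℝ) ^ 2 - numRealRoots c) ∂(kssMeasure d) =
      2 * π * ∫ τ in (0 : ℝ)..(π / 2), pairDensity d τ := by
  have hN := measurable_numRealRoots d
  have hcast : ∀ c : Fin (d + 1) → ℝ, (numRealRoots c : ℝ) ^ 2 - numRealRoots c =
      ((numRealRoots c * numRealRoots c - numRealRoots c : ℕ) : ℝ) := fun c => by
    rw [Nat.cast_sub (Nat.le_mul_self _), Nat.cast_mul, sq]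
  simp_rw [hcast]
  rw [integral_eq_lintegral_of_nonneg_ae (ae_of_all _ fun c => Nat.cast_nonneg _)
    ((measurable_from_top (f := fun n : ℕ => ((n * n - n : ℕ) : ℝ))).comp hN).aestronglyMeasurable]
  simp_rw [ENNReal.ofReal_natCast]
  obtain ⟨k, rfl⟩ : ∃ k, d = k + 1 := ⟨d - 1, by omega⟩
  have hper : Function.Periodic (fun τ => ENNReal.ofReal (pairDensity (k + 1) τ)) π :=
    fun τ => by simp only [pairDensity_periodic hd τ]
  rw [lintegral_factorial_numRealRoots,
    setLIntegral_anglePairs_sub (measurable_pairDensity _).ennreal_ofReal hper,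
    ENNReal.toReal_mul, ENNReal.toReal_ofReal pi_pos.le]
  have h1 := integral_eq_lintegral_of_nonneg_ae
    (μ := (volume : Measure ℝ).restrict (Set.Ioc (-(π / 2)) (π / 2)))
    (ae_of_all _ (pairDensity_nonneg (d := k + 1) (by omega)))
    (measurable_pairDensity _).aestronglyMeasurable
  rw [← h1, ← integral_Icc_eq_integral_Ioc, ← integral_indicator measurableSet_Icc]
  have h2 := integral_comp_abs (f := (Set.Iic (π / 2)).indicator (pairDensity (k + 1)))
  have h3 : ∀ x : ℝ, (Set.Iic (π / 2)).indicator (pairDensity (k + 1)) |x| =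
      (Set.Icc (-(π / 2)) (π / 2)).indicator (pairDensity (k + 1)) x := fun x => by
    have he : pairDensity (k + 1) |x| = pairDensity (k + 1) x := by
      rcases abs_choice x with h | h <;> rw [h]
      exact pairDensity_neg _ _
    simp only [Set.indicator_apply, Set.mem_Iic, Set.mem_Icc, abs_le, he]
  simp_rw [h3] at h2
  rw [h2, setIntegral_indicator measurableSet_Iic, Set.Ioi_inter_Iic,
    intervalIntegral.integral_of_le (by positivity)]
  ring

end Variance

/-! ### The scale-free form of the density of pairs -/

section Profile

open Real

/-- The scale-free form of `pairDensity`, as a function of the covariance `k`, the square `b` of its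
first derivative and its second derivative `c`, the derivatives being normalized by the variance of
the derivative of the process. -/
noncomputable def densityProfile (k b c : ℝ) : ℝ :=
  (1 - b / (1 - k ^ 2)) / √(1 - k ^ 2) *
    absMoment ((-c - k * (b / (1 - k ^ 2))) / (1 - b / (1 - k ^ 2)))

theorem kssCondVar_eq {d : ℕ} (hd : d ≠ 0) (τ : ℝ) :
    kssCondVar d τ = d * (1 - kssCovDeriv d τ ^ 2 / d / (1 - kssCov d τ ^ 2)) := by
  rw [kssCondVar, mul_sub, mul_one, div_right_comm, mul_div_cancel₀ _ (Nat.cast_ne_zero.2 hd)]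

theorem kssCondCorr_eq {d : ℕ} (hd : d ≠ 0) (τ : ℝ) :
    kssCondCorr d τ = (-(kssCovDeriv₂ d τ / d) -
      kssCov d τ * (kssCovDeriv d τ ^ 2 / d / (1 - kssCov d τ ^ 2))) /
        (1 - kssCovDeriv d τ ^ 2 / d / (1 - kssCov d τ ^ 2)) := by
  have hd' : (d : ℝ) ≠ 0 := Nat.cast_ne_zero.2 hd
  rw [kssCondCorr, kssCondVar_eq hd, div_right_comm (kssCovDeriv d τ ^ 2),
    mul_div_assoc (kssCov d τ)]
  set y := kssCovDeriv d τ ^ 2 / (1 - kssCov d τ ^ 2)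
  rw [show -kssCovDeriv₂ d τ - kssCov d τ * y =
    d * (-(kssCovDeriv₂ d τ / d) - kssCov d τ * (y / d)) by field_simp, mul_div_mul_left _ _ hd']

theorem pairDensity_eq_densityProfile {d : ℕ} (hd : d ≠ 0) (τ : ℝ) :
    pairDensity d τ = d / π ^ 2 *
      densityProfile (kssCov d τ) (kssCovDeriv d τ ^ 2 / d) (kssCovDeriv₂ d τ / d) := by
  rw [pairDensity, kssCondCorr_eq hd, kssCondVar_eq hd, densityProfile]
  ring

theorem abs_absMoment_sub_one_le {ρ : ℝ} (hρ : |ρ| ≤ 1) : |absMoment ρ - 1| ≤ 2 * |ρ| := by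
  have h0 := abs_nonneg ρ
  have hsq : ρ ^ 2 = |ρ| ^ 2 := (sq_abs ρ).symm
  have h1 : √(1 - ρ ^ 2) ≤ 1 := sqrt_le_one.2 (by nlinarith)
  have h2 : 1 - |ρ| ≤ √(1 - ρ ^ 2) := le_sqrt_of_sq_le (by nlinarith)
  have h3 : |ρ * arcsin ρ| ≤ |ρ| * 2 := by
    rw [abs_mul]
    refine mul_le_mul_of_nonneg_left (abs_le.2 ⟨?_, ?_⟩) h0
    · linarith [neg_pi_div_two_le_arcsin ρ, pi_le_four]
    · linarith [arcsin_le_pi_div_two ρ, pi_le_four]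
  have h4 : 0 ≤ ρ * arcsin ρ := by
    rcases le_total 0 ρ with h | h
    · exact mul_nonneg h (arcsin_nonneg.2 h)
    · exact mul_nonneg_of_nonpos_of_nonpos h (arcsin_nonpos.2 h)
  rw [abs_of_nonneg h4] at h3
  rw [absMoment, abs_le]
  constructor <;> linarith

/-- At small correlations the two zeros are nearly independent, and the profile is close to `1`. -/
theorem abs_densityProfile_sub_one_le {k b c δ : ℝ} (hδ : δ ≤ 1 / 4) (hk : |k| ≤ δ) (hb : 0 ≤ b)
    (hbδ : b ≤ δ) (hc : |c| ≤ δ) : |densityProfile k b c - 1| ≤ 11 * δ := by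
  have hδ0 : 0 ≤ δ := hb.trans hbδ
  have hk2 : k ^ 2 ≤ δ ^ 2 := by rw [← sq_abs]; exact pow_le_pow_left₀ (abs_nonneg k) hk 2
  have hu : 3 / 4 ≤ 1 - k ^ 2 := by nlinarith
  set y := b / (1 - k ^ 2) with hy
  have hy0 : 0 ≤ y := div_nonneg hb (by linarith)
  have hy1 : y ≤ 4 / 3 * δ := by rw [hy, div_le_iff₀ (by linarith)]; nlinarith
  have hV : 1 / 2 ≤ 1 - y := by linarith
  set w := √(1 - k ^ 2) with hw
  have hw1 : w ≤ 1 := sqrt_le_one.2 (by nlinarith [sq_nonneg k])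
  have hw2 : 1 - k ^ 2 ≤ w := le_sqrt_of_sq_le (by nlinarith [sq_nonneg k])
  have hw0 : 0 < w := by linarith
  have hA1 : (1 - y) / w ≤ 1 + 2 * δ := by rw [div_le_iff₀ hw0]; nlinarith
  have hA0 : 1 - 2 * δ ≤ (1 - y) / w := by rw [le_div_iff₀ hw0]; nlinarith
  set A := (1 - y) / w with hA
  set ρ := (-c - k * y) / (1 - y) with hρ
  have hρ1 : |ρ| ≤ 3 * δ := by
    rw [hρ, abs_div, abs_of_pos (by linarith : 0 < 1 - y), div_le_iff₀ (by linarith)]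
    have h1 : |k * y| ≤ δ * y := by rw [abs_mul, abs_of_nonneg hy0]; gcongr
    have h2 : |-c - k * y| ≤ |c| + |k * y| := by
      have := abs_sub (-c) (k * y); rwa [abs_neg] at this
    nlinarith
  have hM := abs_absMoment_sub_one_le (ρ := ρ) (by linarith)
  rw [densityProfile, ← hy, ← hw, ← hρ, ← hA]
  have h1 : A * absMoment ρ - 1 = A * (absMoment ρ - 1) + (A - 1) := by ring
  have h2 : |A * (absMoment ρ - 1)| ≤ (1 + 2 * δ) * (6 * δ) := by
    rw [abs_mul]
    refine mul_le_mul ?_ (by linarith) (abs_nonneg _) (by linarith)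
    rw [abs_le]; constructor <;> linarith
  have h3 : |A - 1| ≤ 2 * δ := by rw [abs_le]; constructor <;> linarith
  rw [h1]
  refine (abs_add_le _ _).trans ?_
  nlinarith

/-- The zeros repel each other: when `1 - k ^ 2 - b` is of order `t ^ 4` while `1 - k ^ 2` is of
order `t ^ 2`, the profile is of order `t`. -/
theorem densityProfile_mem_Icc {k b c t : ℝ} (ht : 0 < t)
    (hk : t ^ 2 / (4 + t ^ 2) ≤ 1 - k ^ 2) (hb : b ≤ 1 - k ^ 2) (hkb : 1 - k ^ 2 - b ≤ t ^ 4)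
    (hρ : ((-c - k * (b / (1 - k ^ 2))) / (1 - b / (1 - k ^ 2))) ^ 2 ≤ 1) :
    densityProfile k b c ∈ Set.Icc 0 (3 * (t * (4 + t ^ 2) * (2 + t))) := by
  set ρ := (-c - k * (b / (1 - k ^ 2))) / (1 - b / (1 - k ^ 2)) with hρd
  have hM0 := absMoment_nonneg ρ
  have hρ1 : |ρ| ≤ 1 := by rwa [← sq_le_one_iff_abs_le_one]
  have hM : absMoment ρ ≤ 3 := by
    have := (abs_le.1 (abs_absMoment_sub_one_le hρ1)).2
    linarith
  set u := 1 - k ^ 2 with hu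
  have hu0 : 0 < u := lt_of_lt_of_le (by positivity) hk
  have hw : t / (2 + t) ≤ √u := by
    refine le_sqrt_of_sq_le (le_trans ?_ hk)
    rw [div_pow]
    gcongr
    nlinarith
  have hV : 1 - b / u = (u - b) / u := by field_simp
  have hV0 : 0 ≤ (u - b) / u := div_nonneg (by linarith) hu0.le
  have hA : (u - b) / u / √u ≤ t * (4 + t ^ 2) * (2 + t) := by
    have hp : t ^ 2 / (4 + t ^ 2) * (t / (2 + t)) ≤ u * √u :=
      mul_le_mul hk hw (by positivity) hu0.le
    rw [div_div]
    calc (u - b) / (u * √u) ≤ t ^ 4 / (t ^ 2 / (4 + t ^ 2) * (t / (2 + t))) := by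
          gcongr
      _ = t * (4 + t ^ 2) * (2 + t) := by field_simp
  rw [densityProfile, ← hu, ← hρd, hV]
  refine ⟨mul_nonneg (div_nonneg hV0 (sqrt_nonneg _)) hM0, ?_⟩
  rw [mul_comm 3]
  exact mul_le_mul hA hM hM0 (by positivity)

theorem continuous_absMoment : Continuous absMoment := by
  unfold absMoment
  fun_prop

/-- The profile of the stationary process with covariance `exp (-t ^ 2 / 2)`, the limit of the
scaled profiles. -/
noncomputable def limitProfile (t : ℝ) : ℝ :=
  densityProfile (exp (-t ^ 2 / 2)) (t ^ 2 * exp (-t ^ 2 / 2) ^ 2)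
    (t ^ 2 * exp (-t ^ 2 / 2) - exp (-t ^ 2 / 2))

theorem exp_neg_sq_eq (t : ℝ) : exp (-t ^ 2) = exp (-t ^ 2 / 2) ^ 2 := by
  rw [← exp_nat_mul]; congr 1; push_cast; ring

/-- A form of `v < sinh v`. -/
theorem two_mul_mul_exp_neg_lt {v : ℝ} (hv : 0 < v) :
    2 * v * exp (-v) < 1 - exp (-v) ^ 2 := by
  have h := self_lt_sinh_iff.2 hv
  rw [sinh_eq] at h
  have h1 : exp v * exp (-v) = 1 := by rw [← exp_add]; simp
  have h2 := exp_pos (-v)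
  nlinarith

/-- The correlation is strictly between `-1` and `1`, so that the arctangent in `kssIntegrand` is
`arcsin (kssRho t)`. With `w = exp (-t ^ 2 / 2)`, the sum and the difference of the denominator
and the numerator factor as `(1 + w) * (1 - w ^ 2 - t ^ 2 * w)` and
`(1 - w) * (1 - w ^ 2 + t ^ 2 * w)`. -/
theorem kssRho_denom_pos_and_abs_lt_one {t : ℝ} (ht : 0 < t) :
    0 < 1 - exp (-t ^ 2 / 2) ^ 2 - t ^ 2 * exp (-t ^ 2 / 2) ^ 2 ∧ |kssRho t| < 1 := by
  have hv : 0 < t ^ 2 / 2 := by positivity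
  have h1 := two_mul_mul_exp_neg_lt hv
  rw [kssRho, exp_neg_sq_eq]
  rw [show -(t ^ 2 / 2) = -t ^ 2 / 2 by ring] at h1
  have hw1 : exp (-t ^ 2 / 2) < 1 := exp_lt_one_iff.2 (by nlinarith)
  have hw0 := exp_pos (-t ^ 2 / 2)
  set w := exp (-t ^ 2 / 2)
  have hw2 : w ^ 2 < w := by nlinarith
  have ht2 : 0 < t ^ 2 := by positivity
  have hD : 0 < 1 - w ^ 2 - t ^ 2 * w ^ 2 := by nlinarith
  refine ⟨hD, ?_⟩
  rw [← mul_div_assoc, abs_div, abs_of_pos hD, div_lt_one hD, abs_lt]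
  constructor
  · nlinarith
  · have : 0 < (1 - w) * (1 - w ^ 2) + t ^ 2 * w * (1 - w) := by
      have : 0 < 1 - w := by linarith
      have : 0 < 1 - w ^ 2 := by linarith
      positivity
    nlinarith

theorem kssIntegrand_eq {t : ℝ} (ht : 0 < t) : kssIntegrand t = limitProfile t - 1 := by
  obtain ⟨hD, hρ⟩ := kssRho_denom_pos_and_abs_lt_one ht
  have hw1 : exp (-t ^ 2 / 2) < 1 := exp_lt_one_iff.2 (by nlinarith)
  have hw0 := exp_pos (-t ^ 2 / 2)
  have hM : √(1 - kssRho t ^ 2) +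
      kssRho t * arctan (kssRho t / √(1 - kssRho t ^ 2)) = absMoment (kssRho t) := by
    rw [absMoment, arcsin_eq_arctan]
    exact abs_lt.1 hρ
  rw [kssIntegrand, hM, limitProfile, densityProfile]
  have hu : 0 < 1 - exp (-t ^ 2 / 2) ^ 2 := by nlinarith
  congr 2
  · rw [kssG, exp_neg_sq_eq, show (3 / 2 : ℝ) = 1 + 1 / 2 by norm_num, rpow_add hu, rpow_one,
      ← sqrt_eq_rpow, one_sub_div hu.ne', div_div]
    congr 1; ring
  · rw [kssRho, exp_neg_sq_eq]
    set w := exp (-t ^ 2 / 2)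
    have : 1 - t ^ 2 * w ^ 2 / (1 - w ^ 2) = (1 - w ^ 2 - t ^ 2 * w ^ 2) / (1 - w ^ 2) := by
      field_simp
    rw [this]
    congr 1
    rw [← mul_div_assoc, div_eq_div_iff hD.ne' (by positivity)]
    field_simp
    ring

theorem continuousAt_densityProfile {k b c : ℝ} (hk : 0 < 1 - k ^ 2) (hb : 0 < 1 - k ^ 2 - b) :
    ContinuousAt (fun p : ℝ × ℝ × ℝ => densityProfile p.1 p.2.1 p.2.2) (k, b, c) := by
  have hV : 1 - b / (1 - k ^ 2) ≠ 0 := by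
    rw [one_sub_div hk.ne']
    exact (div_pos hb hk).ne'
  have hdiv : ContinuousAt (fun p : ℝ × ℝ × ℝ => p.2.1 / (1 - p.1 ^ 2)) (k, b, c) :=
    ContinuousAt.div (by fun_prop) (by fun_prop) hk.ne'
  unfold densityProfile
  refine ContinuousAt.mul ?_ (continuous_absMoment.continuousAt.comp ?_)
  · have h1 : (fun p : ℝ × ℝ × ℝ => √(1 - p.1 ^ 2)) (k, b, c) ≠ 0 := sqrt_ne_zero'.2 hk
    exact ((continuousAt_const.sub hdiv).div (by fun_prop) h1)
  · exact ContinuousAt.div (by fun_prop) (continuousAt_const.sub hdiv) hV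

end Profile

/-! ### Uniform bounds at the scale of the spacing of zeros -/

section Scaling

open Real

/-- The density profile of the Kostlan-Shub-Smale polynomial of degree `d` at angle `t / √d`, the
scale at which the zeros interact. -/
noncomputable def scaledProfile (d : ℕ) (t : ℝ) : ℝ :=
  densityProfile (kssCov d (t / √d)) (kssCovDeriv d (t / √d) ^ 2 / d)
    (kssCovDeriv₂ d (t / √d) / d)

/-- A bound for the distance of all scaled profiles from `1`. -/
noncomputable def profileBound (t : ℝ) : ℝ :=
  (15 + 12 * (t * (4 + t ^ 2) * (2 + t))) * ((1 + t ^ 2) * exp (-(t ^ 2 / 24)))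

theorem integrableOn_profileBound : IntegrableOn profileBound (Set.Ioi 0) := by
  have h : ∀ n : ℕ, Integrable fun t : ℝ => t ^ n * exp (-(1 / 24) * t ^ 2) := fun n => by
    have := integrable_rpow_mul_exp_neg_mul_sq (b := 1 / 24) (by norm_num) (s := n)
      (by linarith [n.cast_nonneg (α := ℝ)])
    simpa only [rpow_natCast] using this
  refine Integrable.integrableOn ?_
  have he : profileBound = fun t =>
      15 * (t ^ 0 * exp (-(1 / 24) * t ^ 2)) + 96 * (t ^ 1 * exp (-(1 / 24) * t ^ 2)) +
      63 * (t ^ 2 * exp (-(1 / 24) * t ^ 2)) + 120 * (t ^ 3 * exp (-(1 / 24) * t ^ 2)) +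
      60 * (t ^ 4 * exp (-(1 / 24) * t ^ 2)) + 24 * (t ^ 5 * exp (-(1 / 24) * t ^ 2)) +
      12 * (t ^ 6 * exp (-(1 / 24) * t ^ 2)) := by
    ext t
    rw [profileBound, show -(t ^ 2 / 24) = -(1 / 24) * t ^ 2 by ring]
    ring
  rw [he]
  exact (((((((h 0).const_mul _).add ((h 1).const_mul _)).add ((h 2).const_mul _)).add
    ((h 3).const_mul _)).add ((h 4).const_mul _)).add ((h 5).const_mul _)).add ((h 6).const_mul _)

/-- Up to angle `π / 2` the sine is comparable to the angle. -/
theorem mul_sin_sq_mem_Icc {d : ℕ} (hd : d ≠ 0) {t : ℝ} (ht : 0 < t) (htd : t ≤ √d * (π / 2)) :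
    d * sin (t / √d) ^ 2 ∈ Set.Icc (t ^ 2 / 4) (t ^ 2) := by
  have hs : 0 < √(d : ℝ) := sqrt_pos.2 (Nat.cast_pos.2 (Nat.pos_of_ne_zero hd))
  have hτ0 : 0 < t / √d := div_pos ht hs
  have hτ1 : t / √d ≤ π / 2 := by rw [div_le_iff₀ hs]; linarith
  have h1 := sin_le hτ0.le
  have h2 : t / √d / 2 ≤ sin (t / √d) := by
    refine le_trans ?_ (mul_le_sin hτ0.le hτ1)
    have : 1 / 2 ≤ 2 / π := by rw [div_le_div_iff₀ two_pos pi_pos]; linarith [pi_le_four]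
    nlinarith
  have h0 : 0 ≤ sin (t / √d) := le_trans (by positivity) h2
  have hdt : d * (t / √d) ^ 2 = t ^ 2 := by
    rw [div_pow, sq_sqrt (Nat.cast_nonneg d)]
    field_simp
  have hd0 : (0 : ℝ) ≤ d := Nat.cast_nonneg d
  constructor
  · calc t ^ 2 / 4 = d * (t / √d / 2) ^ 2 := by rw [← hdt]; ring
      _ ≤ _ := by gcongr
  · calc _ ≤ (d : ℝ) * (t / √d) ^ 2 := by gcongr
      _ = t ^ 2 := hdt

/-- The numerator of the conditional variance is of fourth order in the distance: Bernoulli's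
inequality is used twice. -/
theorem one_sub_pow_sub_le (m : ℕ) {q : ℝ} (hq0 : 0 ≤ q) (hq1 : q ≤ 1) :
    1 - q ^ (m + 1) - (m + 1) * (1 - q) * q ^ m ≤ ((m + 1) * (1 - q)) ^ 2 := by
  have bern : ∀ n : ℕ, 1 - q ^ n ≤ n * (1 - q) := fun n => by
    have := one_add_mul_le_pow (show (-2 : ℝ) ≤ q - 1 by linarith) n
    rw [add_sub_cancel] at this
    linarith
  have h1 := bern (m + 1)
  have h2 := bern m
  push_cast at h1
  have h3 : 0 ≤ (m + 1) * (1 - q) := mul_nonneg (by positivity) (by linarith)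
  nlinarith

theorem kssCovDeriv_sq_div (m : ℕ) (τ : ℝ) :
    kssCovDeriv (m + 1) τ ^ 2 / (m + 1 : ℕ) =
      ((m + 1 : ℕ) * sin τ ^ 2) * (cos τ ^ m) ^ 2 := by
  have : ((m + 1 : ℕ) : ℝ) ≠ 0 := by positivity
  rw [kssCovDeriv, add_tsub_cancel_right]
  field_simp

theorem kssCovDeriv₂_div (m : ℕ) (τ : ℝ) :
    kssCovDeriv₂ (m + 2) τ / (m + 2 : ℕ) = (m + 1) * sin τ ^ 2 * cos τ ^ m - cos τ ^ (m + 2) := by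
  have : ((m + 2 : ℕ) : ℝ) ≠ 0 := by positivity
  rw [kssCovDeriv₂, show m + 2 - 1 = m + 1 by omega, show m + 2 - 2 = m by omega]
  push_cast at this ⊢
  field_simp
  ring

theorem cos_sq_le_exp (τ : ℝ) : cos τ ^ 2 ≤ exp (-sin τ ^ 2) := by
  rw [cos_sq']
  linarith [add_one_le_exp (-sin τ ^ 2)]

theorem abs_cos_pow_le_exp (τ : ℝ) (m : ℕ) : |cos τ| ^ m ≤ exp (-(m * sin τ ^ 2 / 2)) := by
  refine abs_le_of_sq_le_sq' ?_ (exp_pos _).le |>.2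
  rw [← pow_mul, mul_comm, pow_mul, sq_abs, ← exp_nat_mul]
  refine (pow_le_pow_left₀ (sq_nonneg _) (cos_sq_le_exp τ) m).trans ?_
  rw [← exp_nat_mul]
  refine exp_le_exp.2 (le_of_eq ?_)
  push_cast; ring

/-- The scaled profiles are within a fixed integrable distance from `1`. -/
theorem abs_scaledProfile_sub_one_le {d : ℕ} (hd : 3 ≤ d) {t : ℝ} (ht : 0 < t)
    (htd : t ≤ √d * (π / 2)) : |scaledProfile d t - 1| ≤ profileBound t := by
  obtain ⟨hlo, hhi⟩ := mul_sin_sq_mem_Icc (by omega) ht htd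
  obtain ⟨m, rfl⟩ := Nat.exists_eq_add_of_le' hd
  set τ := t / √((m + 3 : ℕ) : ℝ) with hτ
  set ε := exp (-(t ^ 2 / 24)) with hε
  have hε0 : 0 < ε := exp_pos _
  have hε1 : ε ≤ 1 := exp_le_one_iff.2 (by nlinarith)
  set δ := (1 + t ^ 2) * ε with hδ
  have hc1 : |cos τ| ≤ 1 := abs_cos_le_one τ
  have hs0 : 0 ≤ sin τ ^ 2 := sq_nonneg _
  -- the exponent `d - 2` is at least `d / 3`, which turns `t ^ 2 / 8` into `t ^ 2 / 24`
  have hp : |cos τ| ^ (m + 1) ≤ ε := by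
    refine (abs_cos_pow_le_exp τ _).trans (exp_le_exp.2 ?_)
    push_cast at hlo ⊢
    have : (0 : ℝ) ≤ m * sin τ ^ 2 := by positivity
    nlinarith
  have hp2 : |cos τ| ^ (m + 2) ≤ ε := (pow_le_pow_of_le_one (abs_nonneg _) hc1 (by omega)).trans hp
  have hp3 : |cos τ| ^ (m + 3) ≤ ε := (pow_le_pow_of_le_one (abs_nonneg _) hc1 (by omega)).trans hp
  have hεδ : ε ≤ δ := by nlinarith [mul_nonneg (sq_nonneg t) hε0.le]
  set k := kssCov (m + 3) τ with hk
  set b := kssCovDeriv (m + 3) τ ^ 2 / (m + 3 : ℕ) with hb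
  set c := kssCovDeriv₂ (m + 3) τ / (m + 3 : ℕ) with hc
  have hb' : b = ((m + 3 : ℕ) * sin τ ^ 2) * (cos τ ^ (m + 2)) ^ 2 := kssCovDeriv_sq_div (m + 2) τ
  have hc' : c = (((m + 1 : ℕ) : ℝ) + 1) * sin τ ^ 2 * cos τ ^ (m + 1) - cos τ ^ (m + 3) :=
    kssCovDeriv₂_div (m + 1) τ
  have hb0 : 0 ≤ b := by positivity
  have hpoly : 0 ≤ t * (4 + t ^ 2) * (2 + t) := by positivity
  have hδ0 : 0 ≤ δ := by positivity
  have hG : profileBound t = (15 + 12 * (t * (4 + t ^ 2) * (2 + t))) * δ := rfl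
  rw [hG]
  -- for `δ ≤ 1 / 4` the correlations are small; otherwise `1 ≤ 4 * δ`, and boundedness suffices
  rcases le_total δ (1 / 4) with h4 | h4
  · have hkδ : |k| ≤ δ := by rw [hk, kssCov, abs_pow]; exact hp3.trans hεδ
    have hbδ : b ≤ δ := by
      rw [hb', ← sq_abs (cos τ ^ (m + 2)), abs_pow]
      have h1 : (|cos τ| ^ (m + 2)) ^ 2 ≤ ε := by
        have : 0 ≤ |cos τ| ^ (m + 2) := by positivity
        nlinarith
      calc _ ≤ t ^ 2 * ε := mul_le_mul hhi h1 (by positivity) (sq_nonneg t)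
        _ ≤ δ := by rw [hδ]; nlinarith
    have hcδ : |c| ≤ δ := by
      rw [hc']
      refine (abs_sub _ _).trans ?_
      rw [abs_mul, abs_pow, abs_pow, abs_of_nonneg (by positivity)]
      have h1 : (((m + 1 : ℕ) : ℝ) + 1) * sin τ ^ 2 ≤ t ^ 2 := by
        refine le_trans ?_ hhi
        push_cast
        nlinarith
      have h2 := mul_le_mul h1 hp (by positivity) (sq_nonneg t)
      rw [hδ]; linarith
    refine (abs_densityProfile_sub_one_le h4 hkδ hb0 hbδ hcδ).trans ?_
    nlinarith [mul_nonneg hpoly hδ0]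
  · have hd0 : (0 : ℝ) < (m + 3 : ℕ) := by positivity
    have hsin : sin τ ≠ 0 := by
      intro h
      rw [h, zero_pow two_ne_zero, mul_zero] at hlo
      linarith only [hlo, pow_pos ht 2]
    have hk1 := kssCov_sq_lt_one (d := m + 3) (by omega) hsin
    obtain ⟨hV, hR⟩ := kssCondVar_nonneg_and_kssCondCorr_sq_le_one (d := m + 3) (by omega) hsin
    have hq : k ^ 2 = (cos τ ^ 2) ^ (m + 3) := by rw [hk, kssCov, ← pow_mul, mul_comm, pow_mul]
    have hq' : (cos τ ^ (m + 2)) ^ 2 = (cos τ ^ 2) ^ (m + 2) := by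
      rw [← pow_mul, mul_comm, pow_mul]
    have hI := densityProfile_mem_Icc (k := k) (b := b) (c := c) ht ?_ ?_ ?_ ?_
    · set B := t * (4 + t ^ 2) * (2 + t)
      have h1 : (15 + 12 * B) * (1 / 4) ≤ (15 + 12 * B) * δ :=
        mul_le_mul_of_nonneg_left h4 (by linarith only [hpoly])
      have hI' : scaledProfile (m + 3) t ∈ Set.Icc 0 (3 * B) := hI
      refine abs_le.2 ⟨?_, ?_⟩
      · linarith only [hI'.1, h1, hpoly]
      · linarith only [hI'.2, h1, hpoly]
    · have h1 : k ^ 2 ≤ exp (-(t ^ 2 / 4)) := by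
        rw [hq]
        refine (pow_le_pow_left₀ (sq_nonneg _) (cos_sq_le_exp τ) _).trans ?_
        rw [← exp_nat_mul]
        exact exp_le_exp.2 (by linarith)
      have h2 : exp (-(t ^ 2 / 4)) ≤ 1 / (1 + t ^ 2 / 4) := by
        rw [exp_neg, one_div]
        exact inv_anti₀ (by positivity) (by linarith [add_one_le_exp (t ^ 2 / 4)])
      have h3 : t ^ 2 / (4 + t ^ 2) = 1 - 1 / (1 + t ^ 2 / 4) := by field_simp; ring
      linarith
    · have : kssCondVar (m + 3) τ = (m + 3 : ℕ) * (1 - b / (1 - k ^ 2)) :=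
        kssCondVar_eq (by omega) τ
      rw [this] at hV
      have h1 := nonneg_of_mul_nonneg_right hV hd0
      have h2 : b / (1 - k ^ 2) ≤ 1 := by linarith
      rwa [div_le_one (by linarith)] at h2
    · have h1 := one_sub_pow_sub_le (m + 2) (sq_nonneg (cos τ)) (cos_sq_le_one τ)
      have hs : sin τ ^ 2 = 1 - cos τ ^ 2 := sin_sq τ
      rw [hq, hb', hq', hs]
      rw [hs] at hhi
      push_cast at h1 hhi ⊢
      have h2 : 0 ≤ ((m : ℝ) + 3) * (1 - cos τ ^ 2) := by rw [← hs]; positivity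
      have h3 : (((m : ℝ) + 3) * (1 - cos τ ^ 2)) ^ 2 ≤ (t ^ 2) ^ 2 := pow_le_pow_left₀ h2 hhi 2
      rw [show (m : ℝ) + 2 + 1 = m + 3 by ring] at h1
      calc _ ≤ _ := h1
        _ ≤ _ := h3
        _ = t ^ 4 := by ring
    · have : kssCondCorr (m + 3) τ = (-c - k * (b / (1 - k ^ 2))) / (1 - b / (1 - k ^ 2)) :=
        kssCondCorr_eq (by omega) τ
      rwa [← this]

end Scaling

/-! ### Passage to the limit -/

section Limit

open Real

theorem tendsto_div_sqrt_natCast (t : ℝ) :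
    Tendsto (fun d : ℕ => t / √(d : ℝ)) atTop (𝓝 0) :=
  tendsto_const_nhds.div_atTop (tendsto_sqrt_atTop.comp tendsto_natCast_atTop_atTop)

theorem tendsto_mul_sin_sq (t : ℝ) :
    Tendsto (fun d : ℕ => (d : ℝ) * sin (t / √(d : ℝ)) ^ 2) atTop (𝓝 (t ^ 2)) := by
  have h := (continuous_sinc.tendsto 0).comp (tendsto_div_sqrt_natCast t)
  rw [sinc_zero] at h
  have h1 := (h.pow 2).const_mul (t ^ 2)
  rw [one_pow, mul_one] at h1
  refine h1.congr' ?_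
  filter_upwards [eventually_ne_atTop 0] with d hd
  have hd' : 0 < (d : ℝ) := Nat.cast_pos.2 (Nat.pos_of_ne_zero hd)
  have hs := (sqrt_pos.2 hd').ne'
  have hsq := sq_sqrt hd'.le
  simp only [Function.comp_apply]
  by_cases ht : t = 0
  · simp [ht]
  · rw [sinc_of_ne_zero (div_ne_zero ht hs), div_pow, div_pow, hsq]
    field_simp

theorem tendsto_cos_pow (t : ℝ) :
    Tendsto (fun d : ℕ => cos (t / √(d : ℝ)) ^ d) atTop (𝓝 (exp (-t ^ 2 / 2))) := by
  have h : Tendsto (fun d : ℕ => (d : ℝ) * (cos (t / √(d : ℝ)) - 1)) atTop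
      (𝓝 (-t ^ 2 / 2)) := by
    have := (tendsto_mul_sin_sq (t / 2)).const_mul (-2)
    rw [show -2 * (t / 2) ^ 2 = -t ^ 2 / 2 by ring] at this
    refine this.congr fun d => ?_
    have hc : cos (t / √(d : ℝ)) = cos (2 * (t / 2 / √(d : ℝ))) := by congr 1; ring
    rw [hc, cos_two_mul, cos_sq']
    ring
  refine (tendsto_one_add_pow_exp_of_tendsto h).congr fun d => ?_
  rw [add_sub_cancel]

theorem tendsto_scaledProfile {t : ℝ} (ht : 0 < t) :
    Tendsto (fun d => scaledProfile d t) atTop (𝓝 (limitProfile t)) := by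
  have hw1 : exp (-t ^ 2 / 2) < 1 := exp_lt_one_iff.2 (by nlinarith)
  have hw0 := exp_pos (-t ^ 2 / 2)
  have hD := (kssRho_denom_pos_and_abs_lt_one ht).1
  have hcont := continuousAt_densityProfile (k := exp (-t ^ 2 / 2))
    (b := t ^ 2 * exp (-t ^ 2 / 2) ^ 2) (c := t ^ 2 * exp (-t ^ 2 / 2) - exp (-t ^ 2 / 2))
    (by nlinarith) hD
  have hcos : Tendsto (fun d : ℕ => cos (t / √(d : ℝ))) atTop (𝓝 1) := by
    have := (continuous_cos.tendsto 0).comp (tendsto_div_sqrt_natCast t)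
    rwa [cos_zero] at this
  have hsin : Tendsto (fun d : ℕ => sin (t / √(d : ℝ))) atTop (𝓝 0) := by
    have := (continuous_sin.tendsto 0).comp (tendsto_div_sqrt_natCast t)
    rwa [sin_zero] at this
  have hpow := tendsto_cos_pow t
  have hds := tendsto_mul_sin_sq t
  have hne : ∀ᶠ d : ℕ in atTop, cos (t / √(d : ℝ)) ≠ 0 := hcos.eventually_ne one_ne_zero
  have hp1 : Tendsto (fun d : ℕ => cos (t / √(d : ℝ)) ^ (d - 1)) atTop
      (𝓝 (exp (-t ^ 2 / 2))) := by
    have := hpow.div hcos one_ne_zero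
    rw [div_one] at this
    refine this.congr' ?_
    filter_upwards [hne, eventually_ge_atTop 1] with d h hd
    rw [Pi.div_apply, pow_sub₀ _ h hd, pow_one, div_eq_mul_inv]
  have hp2 : Tendsto (fun d : ℕ => cos (t / √(d : ℝ)) ^ (d - 2)) atTop
      (𝓝 (exp (-t ^ 2 / 2))) := by
    have := hpow.div (hcos.pow 2) (by simp)
    rw [one_pow, div_one] at this
    refine this.congr' ?_
    filter_upwards [hne, eventually_ge_atTop 2] with d h hd
    rw [Pi.div_apply, pow_sub₀ _ h hd, div_eq_mul_inv]
  have hb : Tendsto (fun d : ℕ => kssCovDeriv d (t / √(d : ℝ)) ^ 2 / d) atTop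
      (𝓝 (t ^ 2 * exp (-t ^ 2 / 2) ^ 2)) := by
    refine (hds.mul (hp1.pow 2)).congr' ?_
    filter_upwards [eventually_ge_atTop 1] with d hd
    obtain ⟨m, rfl⟩ := Nat.exists_eq_add_of_le' hd
    rw [kssCovDeriv_sq_div, Nat.add_sub_cancel]
  have hc : Tendsto (fun d : ℕ => kssCovDeriv₂ d (t / √(d : ℝ)) / d) atTop
      (𝓝 (t ^ 2 * exp (-t ^ 2 / 2) - exp (-t ^ 2 / 2))) := by
    have h1 := ((hds.sub (hsin.pow 2)).mul hp2).sub hpow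
    rw [zero_pow two_ne_zero, sub_zero] at h1
    refine h1.congr' ?_
    filter_upwards [eventually_ge_atTop 2] with d hd
    obtain ⟨m, rfl⟩ := Nat.exists_eq_add_of_le' hd
    rw [kssCovDeriv₂_div, Nat.add_sub_cancel]
    push_cast
    ring
  have hk : Tendsto (fun d : ℕ => kssCov d (t / √(d : ℝ))) atTop (𝓝 (exp (-t ^ 2 / 2))) := hpow
  have h := hcont.tendsto.comp (hk.prodMk_nhds (hb.prodMk_nhds hc))
  simp only [Function.comp_def] at h
  exact h

theorem abs_limitProfile_sub_one_le {t : ℝ} (ht : 0 < t) :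
    |limitProfile t - 1| ≤ profileBound t := by
  refine le_of_tendsto ((tendsto_scaledProfile ht).sub_const 1).abs ?_
  have h : Tendsto (fun d : ℕ => √(d : ℝ) * (π / 2)) atTop atTop :=
    (tendsto_sqrt_atTop.comp tendsto_natCast_atTop_atTop).atTop_mul_const (by positivity)
  filter_upwards [eventually_ge_atTop 3, h.eventually_ge_atTop t] with d hd htd
  exact abs_scaledProfile_sub_one_le hd ht htd

theorem measurable_densityProfile_comp {k b c : ℝ → ℝ} (hk : Measurable k) (hb : Measurable b)
    (hc : Measurable c) : Measurable fun t => densityProfile (k t) (b t) (c t) := by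
  unfold densityProfile
  refine Measurable.mul (by fun_prop) (continuous_absMoment.measurable.comp (by fun_prop))

theorem measurable_scaledProfile (d : ℕ) : Measurable (scaledProfile d) := by
  refine measurable_densityProfile_comp ?_ ?_ ?_
  · unfold kssCov; fun_prop
  · unfold kssCovDeriv; fun_prop
  · unfold kssCovDeriv₂; fun_prop

theorem measurable_limitProfile : Measurable limitProfile :=
  measurable_densityProfile_comp (by fun_prop) (by fun_prop) (by fun_prop)

theorem integrableOn_limitProfile_sub_one :
    IntegrableOn (fun t => limitProfile t - 1) (Set.Ioi 0) := by
  refine Integrable.mono' integrableOn_profileBound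
    (measurable_limitProfile.sub_const 1).aestronglyMeasurable ?_
  exact ae_restrict_of_forall_mem measurableSet_Ioi fun t ht => abs_limitProfile_sub_one_le ht

theorem integrableOn_scaledProfile_sub_one {d : ℕ} (hd : 3 ≤ d) :
    IntegrableOn (fun t => scaledProfile d t - 1) (Set.Ioc 0 (√d * (π / 2))) := by
  refine Integrable.mono' (integrableOn_profileBound.mono_set Set.Ioc_subset_Ioi_self)
    ((measurable_scaledProfile d).sub_const 1).aestronglyMeasurable ?_
  exact ae_restrict_of_forall_mem measurableSet_Ioc fun t ht =>
    abs_scaledProfile_sub_one_le hd ht.1 ht.2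

theorem tendsto_setIntegral_scaledProfile_sub_one :
    Tendsto (fun d : ℕ => ∫ t in Set.Ioc 0 (√(d : ℝ) * (π / 2)), (scaledProfile d t - 1)) atTop
      (𝓝 (∫ t in Set.Ioi (0 : ℝ), (limitProfile t - 1))) := by
  have hrad : Tendsto (fun d : ℕ => √(d : ℝ) * (π / 2)) atTop atTop :=
    (tendsto_sqrt_atTop.comp tendsto_natCast_atTop_atTop).atTop_mul_const (by positivity)
  have h := tendsto_integral_filter_of_dominated_convergence (l := atTop)
    (μ := (volume : Measure ℝ).restrict (Set.Ioi 0))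
    (F := fun d : ℕ => (Set.Iic (√(d : ℝ) * (π / 2))).indicator fun t => scaledProfile d t - 1)
    (f := fun t => limitProfile t - 1) profileBound ?_ ?_ integrableOn_profileBound ?_
  · refine h.congr fun d => ?_
    rw [setIntegral_indicator measurableSet_Iic, Set.Ioi_inter_Iic]
  · exact Eventually.of_forall fun d => (((measurable_scaledProfile d).sub_const 1).indicator
      measurableSet_Iic).aestronglyMeasurable
  · filter_upwards [eventually_ge_atTop 3] with d hd
    refine ae_restrict_of_forall_mem measurableSet_Ioi fun t ht => ?_
    rw [Set.indicator_apply]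
    split_ifs with h
    · exact abs_scaledProfile_sub_one_le hd ht h
    · rw [norm_zero]
      exact (abs_nonneg _).trans (abs_limitProfile_sub_one_le ht)
  · refine ae_restrict_of_forall_mem measurableSet_Ioi fun t ht => ?_
    refine ((tendsto_scaledProfile ht).sub_const 1).congr' ?_
    filter_upwards [hrad.eventually_ge_atTop t] with d hd
    rw [Set.indicator_of_mem (Set.mem_Iic.2 hd)]

/-- The exact formula for the variance: the number of pairs of zeros is compared with the square
of the expected number of zeros, and the single zeros contribute the summand `1`. -/
theorem variance_numRealRoots_div_sqrt {d : ℕ} (hd : 3 ≤ d) :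
    Var[fun c => (numRealRoots c : ℝ); kssMeasure d] / √d =
      2 / π * (∫ t in Set.Ioc 0 (√(d : ℝ) * (π / 2)), (scaledProfile d t - 1)) + 1 := by
  have hd0 : 0 < (d : ℝ) := Nat.cast_pos.2 (by omega)
  have hs := sqrt_pos.2 hd0
  have hL := memLp_numRealRoots (kssMeasure d)
  have hfac := integral_factorial_numRealRoots (d := d) (by omega)
  rw [integral_sub hL.integrable_sq (hL.integrable one_le_two), integral_numRealRoots] at hfac
  have hint : IntegrableOn (fun t => scaledProfile d t) (Set.Ioc 0 (√d * (π / 2))) := by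
    have h1 : IntegrableOn (fun _ : ℝ => (1 : ℝ)) (Set.Ioc 0 (√d * (π / 2))) :=
      integrableOn_const measure_Ioc_lt_top.ne
    refine ((integrableOn_scaledProfile_sub_one hd).add h1).congr (ae_of_all _ fun t => ?_)
    exact sub_add_cancel _ _
  have hscale : ∫ τ in (0 : ℝ)..(π / 2), pairDensity d τ =
      √d / π ^ 2 * ∫ t in Set.Ioc 0 (√(d : ℝ) * (π / 2)), scaledProfile d t := by
    have h1 := intervalIntegral.integral_comp_div (a := 0) (b := √d * (π / 2))
      (fun τ => pairDensity d τ) hs.ne'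
    rw [zero_div, mul_div_cancel_left₀ _ hs.ne', smul_eq_mul] at h1
    have h2 : ∀ t, pairDensity d (t / √d) = d / π ^ 2 * scaledProfile d t := fun t =>
      pairDensity_eq_densityProfile (by omega) _
    simp_rw [h2] at h1
    rw [intervalIntegral.integral_const_mul, intervalIntegral.integral_of_le (by positivity)] at h1
    have h3 : (d : ℝ) = √d * √d := (mul_self_sqrt hd0.le).symm
    refine mul_left_cancel₀ hs.ne' (h1.symm.trans ?_)
    nth_rewrite 1 [h3]
    ring
  rw [variance_eq_sub hL, integral_numRealRoots]
  have hpow : ∫ c, ((fun c => (numRealRoots c : ℝ)) ^ 2) c ∂(kssMeasure d) =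
      ∫ c, (numRealRoots c : ℝ) ^ 2 ∂(kssMeasure d) := rfl
  rw [hpow, eq_add_of_sub_eq hfac, hscale, integral_sub hint
    (integrableOn_const measure_Ioc_lt_top.ne), setIntegral_const, measureReal_def, volume_Ioc,
    sub_zero, ENNReal.toReal_ofReal (by positivity), smul_eq_mul]
  field_simp
  ring

end Limit

/-- The variance of the number of real roots of Kostlan-Shub-Smale polynomials, divided by `√d`,
converges to an explicit finite constant. -/
theorem proposition1 {Ω : ℕ → Type*} [∀ d, MeasurableSpace (Ω d)]
    (P : ∀ d, Measure (Ω d)) [∀ d, IsProbabilityMeasure (P d)]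
    (a : ∀ d, Fin (d + 1) → Ω d → ℝ) (ha : ∀ d, IsKSS (P d) d (a d)) :
    (∀ d, MemLp (rootCount (a d)) 2 (P d)) ∧
    IntegrableOn kssIntegrand (Set.Ioi 0) ∧
    Tendsto (fun d : ℕ => Var[rootCount (a d); P d] / √(d : ℝ)) atTop
      (𝓝 (2 / Real.pi * (∫ t in Set.Ioi (0 : ℝ), kssIntegrand t) + 1)) := by
  have heq : Set.EqOn kssIntegrand (fun t => limitProfile t - 1) (Set.Ioi 0) :=
    fun t ht => kssIntegrand_eq ht
  refine ⟨fun d => (ha d).memLp_rootCount,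
    integrableOn_limitProfile_sub_one.congr_fun heq.symm measurableSet_Ioi, ?_⟩
  rw [setIntegral_congr_fun measurableSet_Ioi heq]
  refine ((tendsto_setIntegral_scaledProfile_sub_one.const_mul _).add_const 1).congr' ?_
  filter_upwards [eventually_ge_atTop 3] with d hd
  rw [(ha d).variance_rootCount, variance_numRealRoots_div_sqrt hd]
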